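/- Let $A$ be an integral domain with field of fractions $K$. Suppose that $|\cdot|$ is a nontrivial absolute value on $K$ (real-valued, archimedean or not) such that $|a|\ge 1$ for every $a\in A\setminus\{0\}$, and let $\overline{K}$ be the completion of $K$ for this absolute value, to which $|\cdot|$ extends. Let $\gamma=(1+\sqrt5)/2$ be the golden ratio. For $\xi\in\overline{K}$ and real numbers $c>0$, $X>0$, consider the inequalities $$|x_0|\le X\quad\text{and}\quad \max\{|x_0\xi-x_1|,\,|x_0\xi^2-x_2|\}\le c\,X^{-1/\gamma}.\qquad (*)$$ (a) Suppose that $A$ is a unique factorization domain. Then, for every $\xi\in\overline{K}$ such that $1,\xi,\xi^2$ are linearly independent over $K$, there exist a constant $c_1>0$ and arbitrarily large real numbers $X$ for which the inequalities $(*)$ with $c=c_1$ have no nonzero solution $(x_0,x_1,x_2)\in A^3$. (b) ($A$ not necessarily a unique factorization domain.) There exist $\xi\in\overline{K}$ such that $1,\xi,\xi^2$ are linearly independent over $K$, and a constant $c_2>0$, such that for every sufficiently large real number $X$ the inequalities $(*)$ with $c=c_2$ have a nonzero solution $(x_0,x_1,x_2)\in A^3$. Moreover $\xi$ can be taken of the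 following form: there are elements $a\ne b$ of $A$ with $|a|>2$ and $|b|>2$ such that $\xi$ is the limit in $\overline{K}$ of the convergents of the continued fraction $[0,a,b,a,a,b,\dots]$ whose partial quotients after the initial $0$ are the letters of the infinite Fibonacci word on $\{a,b\}$, that is, of the limit of the words $w_1=a$, $w_2=ab$, $w_i=w_{i-1}w_{i-2}$ $(i\ge 3)$. -/

import Mathlib

open Filter Topology

/-- The sequence of finite Fibonacci words on the letters `a`, `b` (indexed from `0`):
`a`, `ab`, `aba`, `abaab`, ..., each one being the concatenation of the two previous ones. -/
def fibWord {α : Type*} (a b : α) : ℕ → List α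
  | 0 => [a]
  | 1 => [a, b]
  | n + 2 => fibWord a b (n + 1) ++ fibWord a b n

theorem lt_length_fibWord {α : Type*} (a b : α) : ∀ n : ℕ, n < (fibWord a b n).length
  | 0 => by simp [fibWord]
  | 1 => by simp [fibWord]
  | n + 2 => by
      have h1 := lt_length_fibWord a b (n + 1)
      have h2 := lt_length_fibWord a b n
      simp only [fibWord, List.length_append]
      omega

/-- The letters `u 0, u 1, u 2, ...` of the infinite Fibonacci word `abaababa...`, the limit of the
words `fibWord a b n`: the letter of index `n` is read off the word of index `n`, which has more
than `n` letters. -/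
def fibLetter {α : Type*} (a b : α) (n : ℕ) : α :=
  (fibWord a b n)[n]'(lt_length_fibWord a b n)

theorem fibWord_prefix {α : Type*} (a b : α) (m : ℕ) :
    ∀ k : ℕ, fibWord a b m <+: fibWord a b (m + k)
  | 0 => List.prefix_rfl
  | k + 1 => (fibWord_prefix a b m k).trans (by
      rw [← Nat.add_assoc]
      cases m + k with
      | zero => exact ⟨[b], rfl⟩
      | succ j => exact List.prefix_append _ _)

/-- Every finite Fibonacci word is a prefix of the infinite one. -/
theorem fibLetter_eq {α : Type*} (a b : α) (m j : ℕ) (hj : j < (fibWord a b m).length) :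
    fibLetter a b j = (fibWord a b m)[j] := by
  unfold fibLetter
  rcases le_total j m with h | h
  · obtain ⟨k, rfl⟩ := Nat.exists_eq_add_of_le h
    exact (fibWord_prefix a b j k).getElem _
  · obtain ⟨k, rfl⟩ := Nat.exists_eq_add_of_le h
    exact ((fibWord_prefix a b m k).getElem _).symm

/-- The continued fraction `[0, a, b, a, a, b, ...]` whose partial quotients after the initial `0`
are the letters of the infinite Fibonacci word on `a`, `b`. -/
def fibContFract {F : Type*} [One F] [Zero F] (a b : F) : GenContFract F :=
  ⟨0, Stream'.Seq.ofStream (fun n : ℕ => ⟨1, fibLetter a b n⟩)⟩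

section

variable {A K : Type*} [CommRing A] [Field K] [Algebra A K]

/-- The canonical map from `A` to the completion of `K` for the absolute value `v`. -/
noncomputable def toCompletion (A : Type*) {K : Type*} [CommRing A] [Field K] [Algebra A K]
    (v : AbsoluteValue K ℝ) : A →+* v.Completion :=
  (algebraMap K v.Completion).comp (algebraMap A K)

/-- `L(x) = max (|x₀ ξ - x₁|, |x₀ ξ² - x₂|)`. -/
noncomputable def approxError (v : AbsoluteValue K ℝ) (ξ : v.Completion) (x : Fin 3 → A) : ℝ :=
  max ‖toCompletion A v (x 0) * ξ - toCompletion A v (x 1)‖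
    ‖toCompletion A v (x 0) * ξ ^ 2 - toCompletion A v (x 2)‖

/-- The nonzero point `x` of `A³` satisfies `|x₀| ≤ X` and `L(x) ≤ c X ^ (-1/γ)`, where `γ` is the
golden ratio. -/
def IsSolution (v : AbsoluteValue K ℝ) (ξ : v.Completion) (c X : ℝ) (x : Fin 3 → A) : Prop :=
  x ≠ 0 ∧ v (algebraMap A K (x 0)) ≤ X ∧ approxError v ξ x ≤ c * X ^ (-1 / Real.goldenRatio)

end

/-! Write `L` for the error, `|x 0|` for the height, and `θ = 1/γ`, so that `θ² + θ = 1` and `θ ≥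
1/2`. The arithmetic input is that a nonzero element of `A` has absolute value at least `1`.

Part (a). If `(*)` were solvable for all large `X` with a small `c`, there would be primitive points
`x_i` with errors `L_i` at least halving and `L_i X_{i+1}^θ ≤ 4c`, where `X_i` is the height.
Heights need not be discrete, so each point is minimal only up to a factor `2`. Primitivity keeps
consecutive points from being proportional, and the independence of `1, ξ, ξ²` then yields three
consecutive points `x_i, x_{i+1}, x_{i+2}` with nonzero determinant (`exists_tripleDet_ne_zero`),
whence `1 ≪ X_{i+2} L_{i+1} L_i`. Unique factorization shows that `x_{i+1}` is off the conic `x₀x₂ =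
x₁²` (`symm_det_ne_zero`), whence `1 ≪ X_{i+1} L_{i+1}` and, for small `c`, `X_{i+2}^θ ≤ X_{i+1}`.
As `θ + θ² = 1`, the product `X_{i+2} L_{i+1} L_i` is then at most `16c²`, a contradiction.

Part (b). A Fibonacci word without its last two letters is a palindrome, so its continuant matrix is
symmetric (`fibSym_transpose`) and its three entries approximate the ratio `1 : ξ : ξ²` with error
`≪ 1/Q_n` at height `≪ Q_n` (`fibPoint_bounds`). Concatenation gives `Q_{n+2} ≍ Q_{n+1} Q_n`, so
`Q_{n+1}^θ ≪ Q_n`, and these points cover every large `X` (`exists_uniform_of_seq`). Three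
consecutive points have determinant `±(a - b)`, which forces the independence of `1, ξ, ξ²`. -/

/-! ### Estimates for minors and determinants in terms of height and error. -/

section SimultaneousApproximation

variable {A F : Type*} [CommRing A] [NormedField F] (φ : A →+* F) (ξ : F)

/-- The quantity `max (|x₀ ξ - x₁|, |x₀ ξ² - x₂|)`, for a ring homomorphism to a normed field. -/
noncomputable def simError (x : Fin 3 → A) : ℝ :=
  max ‖φ (x 0) * ξ - φ (x 1)‖ ‖φ (x 0) * ξ ^ 2 - φ (x 2)‖

theorem norm_one_le_simError (x : Fin 3 → A) : ‖φ (x 0) * ξ - φ (x 1)‖ ≤ simError φ ξ x :=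
  le_max_left _ _

theorem norm_two_le_simError (x : Fin 3 → A) : ‖φ (x 0) * ξ ^ 2 - φ (x 2)‖ ≤ simError φ ξ x :=
  le_max_right _ _

theorem simError_nonneg (x : Fin 3 → A) : 0 ≤ simError φ ξ x :=
  (norm_nonneg _).trans (norm_one_le_simError φ ξ x)

theorem simError_smul (d : A) (x : Fin 3 → A) :
    simError φ ξ (d • x) = ‖φ d‖ * simError φ ξ x := by
  simp only [simError, Pi.smul_apply, smul_eq_mul, map_mul, mul_assoc, ← mul_sub, norm_mul]
  rw [mul_max_of_nonneg _ _ (norm_nonneg _)]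

theorem norm_minor_one_le (x y : Fin 3 → A) :
    ‖φ (x 0 * y 1 - x 1 * y 0)‖ ≤ ‖φ (x 0)‖ * simError φ ξ y + ‖φ (y 0)‖ * simError φ ξ x := by
  have h : φ (x 0 * y 1 - x 1 * y 0) =
      φ (y 0) * (φ (x 0) * ξ - φ (x 1)) - φ (x 0) * (φ (y 0) * ξ - φ (y 1)) := by
    simp only [map_sub, map_mul]; ring
  rw [h, add_comm]
  refine (norm_sub_le _ _).trans ?_
  rw [norm_mul, norm_mul]
  gcongr <;> exact norm_one_le_simError φ ξ _

theorem norm_minor_two_le (x y : Fin 3 → A) :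
    ‖φ (x 0 * y 2 - x 2 * y 0)‖ ≤ ‖φ (x 0)‖ * simError φ ξ y + ‖φ (y 0)‖ * simError φ ξ x := by
  have h : φ (x 0 * y 2 - x 2 * y 0) =
      φ (y 0) * (φ (x 0) * ξ ^ 2 - φ (x 2)) - φ (x 0) * (φ (y 0) * ξ ^ 2 - φ (y 2)) := by
    simp only [map_sub, map_mul]; ring
  rw [h, add_comm]
  refine (norm_sub_le _ _).trans ?_
  rw [norm_mul, norm_mul]
  gcongr <;> exact norm_two_le_simError φ ξ _

/-- The form `x₀x₂ - x₁²` vanishes at `(1, ξ, ξ²)`; expanding around that direction leaves only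
terms of size height times error. -/
theorem norm_symm_det_le (x : Fin 3 → A) (h1 : simError φ ξ x ≤ 1) (h0 : 1 ≤ ‖φ (x 0)‖) :
    ‖φ (x 0 * x 2 - x 1 ^ 2)‖ ≤ (2 + 2 * ‖ξ‖) * (‖φ (x 0)‖ * simError φ ξ x) := by
  have h : φ (x 0 * x 2 - x 1 ^ 2) = (φ (x 0) * ξ - φ (x 1)) *
      (2 * φ (x 0) * ξ - (φ (x 0) * ξ - φ (x 1))) - φ (x 0) * (φ (x 0) * ξ ^ 2 - φ (x 2)) := by
    simp only [map_sub, map_mul, map_pow]; ring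
  have e0 := simError_nonneg φ ξ x
  have e1 := norm_one_le_simError φ ξ x
  have e2 := norm_two_le_simError φ ξ x
  have h2 : ‖(2 : F)‖ ≤ 2 := by
    rw [← one_add_one_eq_two]
    exact (norm_add_le _ _).trans (by norm_num)
  have h3 : ‖2 * φ (x 0) * ξ - (φ (x 0) * ξ - φ (x 1))‖ ≤ 2 * ‖φ (x 0)‖ * ‖ξ‖ + ‖φ (x 0)‖ := by
    refine (norm_sub_le _ _).trans ?_
    rw [norm_mul, norm_mul]
    gcongr
    linarith
  calc ‖φ (x 0 * x 2 - x 1 ^ 2)‖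
      ≤ simError φ ξ x * (2 * ‖φ (x 0)‖ * ‖ξ‖ + ‖φ (x 0)‖) + ‖φ (x 0)‖ * simError φ ξ x := by
        rw [h]
        refine (norm_sub_le _ _).trans ?_
        rw [norm_mul, norm_mul]
        gcongr
    _ = _ := by ring

/-- The determinant of three points, expanded along the first row. -/
def tripleDet (x y z : Fin 3 → A) : A :=
  (x 1 * y 2 - x 2 * y 1) * z 0 + (x 2 * y 0 - x 0 * y 2) * z 1 + (x 0 * y 1 - x 1 * y 0) * z 2

theorem norm_tripleDet_le (x y z : Fin 3 → A) :
    ‖φ (tripleDet x y z)‖ ≤ 2 * (‖φ (x 0)‖ * simError φ ξ y * simError φ ξ z +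
      ‖φ (y 0)‖ * simError φ ξ x * simError φ ξ z +
      ‖φ (z 0)‖ * simError φ ξ x * simError φ ξ y) := by
  have key : ∀ a b c : Fin 3 → A, ‖φ (a 0) * ((φ (b 0) * ξ - φ (b 1)) * (φ (c 0) * ξ ^ 2 - φ (c 2)) -
      (φ (b 0) * ξ ^ 2 - φ (b 2)) * (φ (c 0) * ξ - φ (c 1)))‖ ≤
      2 * (‖φ (a 0)‖ * simError φ ξ b * simError φ ξ c) := by
    intro a b c
    have e0 := simError_nonneg φ ξ b
    rw [norm_mul]
    calc _ ≤ ‖φ (a 0)‖ * (simError φ ξ b * simError φ ξ c + simError φ ξ b * simError φ ξ c) := by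
          gcongr
          refine (norm_sub_le _ _).trans ?_
          rw [norm_mul, norm_mul]
          gcongr
          exacts [norm_one_le_simError φ ξ b, norm_two_le_simError φ ξ c,
            norm_two_le_simError φ ξ b, norm_one_le_simError φ ξ c]
      _ = _ := by ring
  have h : φ (tripleDet x y z) =
      φ (x 0) * ((φ (y 0) * ξ - φ (y 1)) * (φ (z 0) * ξ ^ 2 - φ (z 2)) -
        (φ (y 0) * ξ ^ 2 - φ (y 2)) * (φ (z 0) * ξ - φ (z 1))) -
      φ (y 0) * ((φ (x 0) * ξ - φ (x 1)) * (φ (z 0) * ξ ^ 2 - φ (z 2)) -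
        (φ (x 0) * ξ ^ 2 - φ (x 2)) * (φ (z 0) * ξ - φ (z 1))) +
      φ (z 0) * ((φ (x 0) * ξ - φ (x 1)) * (φ (y 0) * ξ ^ 2 - φ (y 2)) -
        (φ (x 0) * ξ ^ 2 - φ (x 2)) * (φ (y 0) * ξ - φ (y 1))) := by
    simp only [tripleDet, map_add, map_sub, map_mul]; ring
  rw [h]
  refine (norm_add_le _ _).trans ?_
  have := (norm_sub_le _ _).trans (add_le_add (key x y z) (key y x z))
  have := add_le_add this (key z x y)
  linarith

variable {φ ξ}

theorem apply_zero_ne_zero_of_simError_lt_one (hφ : ∀ a, a ≠ 0 → 1 ≤ ‖φ a‖) {x : Fin 3 → A}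
    (hx : x ≠ 0) (h : simError φ ξ x < 1) : x 0 ≠ 0 := by
  intro h0
  have h1 := (norm_one_le_simError φ ξ x).trans_lt h
  have h2 := (norm_two_le_simError φ ξ x).trans_lt h
  simp only [h0, map_zero, zero_mul, zero_sub, norm_neg] at h1 h2
  refine hx (funext fun i => ?_)
  fin_cases i
  · exact h0
  · exact not_not.1 fun h => h1.not_ge (hφ _ h)
  · exact not_not.1 fun h => h2.not_ge (hφ _ h)

theorem simError_pos
    (hξ : ∀ a b c : A, φ a + φ b * ξ + φ c * ξ ^ 2 = 0 → a = 0 ∧ b = 0 ∧ c = 0)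
    {x : Fin 3 → A} (hx : x ≠ 0) : 0 < simError φ ξ x := by
  refine (simError_nonneg φ ξ x).lt_of_ne' fun h => hx (funext fun i => ?_)
  have h1 := norm_le_zero_iff.1 ((norm_one_le_simError φ ξ x).trans_eq h)
  have h2 := norm_le_zero_iff.1 ((norm_two_le_simError φ ξ x).trans_eq h)
  have h3 := hξ (-x 1) (x 0) 0 (by simp only [map_neg, map_zero]; linear_combination h1)
  have h4 := hξ (-x 2) 0 (x 0) (by simp only [map_neg, map_zero]; linear_combination h2)
  fin_cases i
  · exact h3.2.1
  · exact neg_eq_zero.1 h3.1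
  · exact neg_eq_zero.1 h4.1

/-- If `n` is orthogonal to points with arbitrarily small error, then `n = 0`. -/
theorem eq_zero_of_orthogonal (hφ : ∀ a, a ≠ 0 → 1 ≤ ‖φ a‖)
    (hξ : ∀ a b c : A, φ a + φ b * ξ + φ c * ξ ^ 2 = 0 → a = 0 ∧ b = 0 ∧ c = 0)
    {x : ℕ → Fin 3 → A} (hx : ∀ i, x i 0 ≠ 0)
    (hlim : Tendsto (fun i => simError φ ξ (x i)) atTop (𝓝 0)) {n0 n1 n2 : A}
    (h : ∀ i, n0 * x i 0 + n1 * x i 1 + n2 * x i 2 = 0) : n0 = 0 ∧ n1 = 0 ∧ n2 = 0 := by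
  apply hξ
  rw [← norm_le_zero_iff]
  have hlim' := hlim.const_mul (‖φ n1‖ + ‖φ n2‖)
  rw [mul_zero] at hlim'
  refine ge_of_tendsto' hlim' fun i => ?_
  have h1 : φ (x i 0) * (φ n0 + φ n1 * ξ + φ n2 * ξ ^ 2) =
      φ n1 * (φ (x i 0) * ξ - φ (x i 1)) + φ n2 * (φ (x i 0) * ξ ^ 2 - φ (x i 2)) := by
    have := congrArg φ (h i)
    simp only [map_add, map_mul, map_zero] at this
    linear_combination this
  calc ‖φ n0 + φ n1 * ξ + φ n2 * ξ ^ 2‖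
      ≤ ‖φ (x i 0)‖ * ‖φ n0 + φ n1 * ξ + φ n2 * ξ ^ 2‖ :=
        le_mul_of_one_le_left (norm_nonneg _) (hφ _ (hx i))
    _ = ‖φ n1 * (φ (x i 0) * ξ - φ (x i 1)) + φ n2 * (φ (x i 0) * ξ ^ 2 - φ (x i 2))‖ := by
        rw [← norm_mul, h1]
    _ ≤ ‖φ n1‖ * simError φ ξ (x i) + ‖φ n2‖ * simError φ ξ (x i) := by
        refine (norm_add_le _ _).trans ?_
        rw [norm_mul, norm_mul]
        gcongr
        exacts [norm_one_le_simError φ ξ _, norm_two_le_simError φ ξ _]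
    _ = _ := by ring

/-- Points of a sequence whose errors tend to `0`, two consecutive ones being never proportional,
do not all lie in a plane. -/
theorem exists_tripleDet_ne_zero [IsDomain A] (hφ : ∀ a, a ≠ 0 → 1 ≤ ‖φ a‖)
    (hξ : ∀ a b c : A, φ a + φ b * ξ + φ c * ξ ^ 2 = 0 → a = 0 ∧ b = 0 ∧ c = 0)
    {x : ℕ → Fin 3 → A} (hx : ∀ i, x i 0 ≠ 0)
    (hlim : Tendsto (fun i => simError φ ξ (x i)) atTop (𝓝 0))
    (hprop : ∀ i, ¬ (x i 0 * x (i + 1) 1 = x i 1 * x (i + 1) 0 ∧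
      x i 0 * x (i + 1) 2 = x i 2 * x (i + 1) 0)) :
    ∃ i, tripleDet (x i) (x (i + 1)) (x (i + 2)) ≠ 0 := by
  by_contra! hdet
  obtain ⟨n0, hn0⟩ : ∃ n, n = x 0 1 * x 1 2 - x 0 2 * x 1 1 := ⟨_, rfl⟩
  obtain ⟨n1, hn1⟩ : ∃ n, n = x 0 2 * x 1 0 - x 0 0 * x 1 2 := ⟨_, rfl⟩
  obtain ⟨n2, hn2⟩ : ∃ n, n = x 0 0 * x 1 1 - x 0 1 * x 1 0 := ⟨_, rfl⟩
  -- The vector `n = x 0 × x 1` stays orthogonal to all points. If `n` is orthogonal to `x i` and `x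
  -- (i + 1)`, it is parallel to their cross product, so each minor times `n · x (i + 2)` is a
  -- coordinate of `n` times the vanishing determinant.
  have horth : ∀ i, (n0 * x i 0 + n1 * x i 1 + n2 * x i 2 = 0) ∧
      (n0 * x (i + 1) 0 + n1 * x (i + 1) 1 + n2 * x (i + 1) 2 = 0) := by
    intro i
    induction i with
    | zero => constructor <;> rw [hn0, hn1, hn2] <;> ring
    | succ i ih =>
      refine ⟨ih.2, ?_⟩
      obtain ⟨ha, hb⟩ := ih
      have hd := hdet i
      unfold tripleDet at hd
      rw [show i + 1 + 1 = i + 2 from rfl]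
      by_contra hne
      refine hprop i ⟨?_, ?_⟩
      · refine sub_eq_zero.1 ((mul_eq_zero.1 (?_ : _ * (n0 * x (i + 2) 0 + n1 * x (i + 2) 1 +
          n2 * x (i + 2) 2) = 0)).resolve_right hne)
        linear_combination n2 * hd + (x i 0 * x (i + 2) 1 - x i 1 * x (i + 2) 0) * hb
          - (x (i + 1) 0 * x (i + 2) 1 - x (i + 1) 1 * x (i + 2) 0) * ha
      · refine sub_eq_zero.1 ((mul_eq_zero.1 (?_ : _ * (n0 * x (i + 2) 0 + n1 * x (i + 2) 1 +
          n2 * x (i + 2) 2) = 0)).resolve_right hne)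
        linear_combination - n1 * hd + (x i 0 * x (i + 2) 2 - x i 2 * x (i + 2) 0) * hb
          - (x (i + 1) 0 * x (i + 2) 2 - x (i + 1) 2 * x (i + 2) 0) * ha
  obtain ⟨-, h1, h2⟩ := eq_zero_of_orthogonal hφ hξ hx hlim fun i => (horth i).1
  refine hprop 0 ⟨?_, ?_⟩
  · rw [hn2] at h2; exact sub_eq_zero.1 h2
  · rw [hn1] at h1; exact (sub_eq_zero.1 h1).symm

end SimultaneousApproximation

/-! ### Primitive points and points of the conic over a unique factorization domain. -/

section Primitive

variable {A : Type*} [CommRing A]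

/-- A point is primitive if its coordinates have no common divisor, in the strong sense that any
common divisor of the coordinates of a multiple `b • x` divides `b`. -/
def IsPrimitivePoint (x : Fin 3 → A) : Prop := ∀ a b : A, (∀ i, a ∣ b * x i) → a ∣ b

theorem exists_primitive [IsDomain A] [UniqueFactorizationMonoid A] {x : Fin 3 → A} (hx : x ≠ 0) :
    ∃ (d : A) (y : Fin 3 → A), d ≠ 0 ∧ x = d • y ∧ IsPrimitivePoint y := by
  classical
  let _ := UniqueFactorizationMonoid.strongNormalizationMonoid (α := A)
  let _ := UniqueFactorizationMonoid.toNormalizedGCDMonoid A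
  obtain ⟨g, hg, hg1⟩ := Finset.extract_gcd (s := Finset.univ) x ⟨0, Finset.mem_univ _⟩
  refine ⟨Finset.univ.gcd x, g, fun h => hx ?_, funext fun i => hg i (Finset.mem_univ i), ?_⟩
  · exact funext fun i => Finset.gcd_eq_zero_iff.1 h i (Finset.mem_univ i)
  · intro a b hab
    have h := Finset.dvd_gcd (s := Finset.univ) (f := fun i => b * g i) fun i _ => hab i
    have h' := (Finset.gcd_mul_left' (s := Finset.univ) (f := g) b).dvd
    rw [hg1, mul_one] at h'
    exact h.trans h'

theorem IsPrimitivePoint.ne_zero [Nontrivial A] {x : Fin 3 → A} (hx : IsPrimitivePoint x) :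
    x ≠ 0 := by
  rintro rfl
  exact zero_ne_one (zero_dvd_iff.1 (hx 0 1 (by simp))).symm

/-- Any point proportional to a primitive point is a multiple of it. -/
theorem IsPrimitivePoint.exists_eq_smul [IsDomain A] {x y : Fin 3 → A} (hx : IsPrimitivePoint x)
    (h0 : x 0 ≠ 0) (h : ∀ i, x 0 * y i = x i * y 0) : ∃ d : A, y = d • x := by
  -- Proportionality says that `x 0` divides every coordinate of `y 0 • x`, so `x 0 ∣ y 0`.
  obtain ⟨d, hd⟩ := hx (x 0) (y 0) fun i => ⟨y i, by rw [h i, mul_comm]⟩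
  refine ⟨d, funext fun i => mul_left_cancel₀ h0 ?_⟩
  rw [h i, hd, Pi.smul_apply, smul_eq_mul]
  ring

/-- Write `a = d p`, `b = d q` with `p`, `q` relatively prime. Then `p c = d q²`, so `p` divides
`d`, and `m = d / p`. -/
theorem exists_eq_mul_sq [IsDomain A] [UniqueFactorizationMonoid A] {a b c : A} (ha : a ≠ 0)
    (h : a * c = b ^ 2) : ∃ m p q, a = m * p ^ 2 ∧ b = m * p * q ∧ c = m * q ^ 2 := by
  let _ := UniqueFactorizationMonoid.toGCDMonoid A
  obtain ⟨p, q, d, hpq, rfl, rfl⟩ := UniqueFactorizationMonoid.exists_reduced_factors a ha b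
  have hd : d ≠ 0 := left_ne_zero_of_mul ha
  have hp : p ≠ 0 := right_ne_zero_of_mul ha
  have h1 : p * c = d * q ^ 2 := mul_left_cancel₀ hd (by linear_combination h)
  obtain ⟨m, rfl⟩ : p ∣ d := (hpq.pow_right (n := 2)).dvd_of_dvd_mul_right ⟨c, h1.symm⟩
  exact ⟨m, p, q, by ring, by ring, mul_left_cancel₀ hp (by linear_combination h1)⟩

end Primitive

/-- The infimum may not be attained, but it is at least `1`, hence strictly below its double. This
replaces the choice of a point of minimal height. -/
theorem exists_forall_le_two_mul {α : Type*} {S : Set α} (hS : S.Nonempty) {f : α → ℝ}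
    (hf : ∀ x ∈ S, 1 ≤ f x) : ∃ x ∈ S, ∀ y ∈ S, f x ≤ 2 * f y := by
  have hb : BddBelow (f '' S) := ⟨1, by rintro _ ⟨x, hx, rfl⟩; exact hf x hx⟩
  have hn : (f '' S).Nonempty := hS.image f
  have h0 : 1 ≤ sInf (f '' S) := le_csInf hn (by rintro _ ⟨x, hx, rfl⟩; exact hf x hx)
  obtain ⟨_, ⟨x, hx, rfl⟩, h⟩ :=
    exists_lt_of_csInf_lt hn (show sInf (f '' S) < 2 * sInf (f '' S) by linarith)
  exact ⟨x, hx, fun y hy => h.le.trans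
    (by linarith [csInf_le hb (Set.mem_image_of_mem f hy)])⟩

open Real in
theorem rpow_goldenRatio_rpow {t : ℝ} (ht : 0 ≤ t) : (t ^ goldenRatio) ^ goldenRatio⁻¹ = t := by
  rw [← rpow_mul ht, mul_inv_cancel₀ goldenRatio_pos.ne', rpow_one]

open Real in
theorem inv_goldenRatio_sq_add : goldenRatio⁻¹ * goldenRatio⁻¹ + goldenRatio⁻¹ = 1 := by
  have h : goldenRatio⁻¹ * goldenRatio = 1 := inv_mul_cancel₀ goldenRatio_pos.ne'
  linear_combination (-goldenRatio⁻¹ ^ 2) * goldenRatio_sq +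
    (goldenRatio⁻¹ * goldenRatio + 1 - goldenRatio⁻¹) * h

open Real in
theorem half_le_inv_goldenRatio : 1 / 2 ≤ goldenRatio⁻¹ := by
  rw [one_div]
  exact inv_anti₀ goldenRatio_pos goldenRatio_lt_two.le

open Real in
theorem inv_goldenRatio_le_one : goldenRatio⁻¹ ≤ 1 :=
  inv_le_one_of_one_le₀ one_lt_goldenRatio.le

/-! ### Part (a): the exponent cannot be improved beyond a constant. -/

section LowerBound

open Real

variable {A F : Type*} [CommRing A] [IsDomain A] [UniqueFactorizationMonoid A] [NormedField F]
  {φ : A →+* F} {ξ : F}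

/-- Primitive points that are almost of minimal height for their error. -/
def IsNearMinimal (φ : A →+* F) (ξ : F) (x : Fin 3 → A) : Prop :=
  IsPrimitivePoint x ∧
    ∀ y, y ≠ 0 → simError φ ξ y ≤ simError φ ξ x → ‖φ (x 0)‖ ≤ 2 * ‖φ (y 0)‖

theorem exists_isNearMinimal (hφ : ∀ a, a ≠ 0 → 1 ≤ ‖φ a‖) {c δ : ℝ} (hc : 0 < c) (hδ : 0 < δ)
    (hδ1 : δ < 1)
    (hsol : ∃ x : Fin 3 → A, x ≠ 0 ∧ ‖φ (x 0)‖ ≤ (c / δ) ^ goldenRatio ∧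
      simError φ ξ x ≤ c * ((c / δ) ^ goldenRatio) ^ (-1 / goldenRatio)) :
    ∃ x, IsNearMinimal φ ξ x ∧ simError φ ξ x ≤ δ ∧ ‖φ (x 0)‖ ^ goldenRatio⁻¹ * δ ≤ 2 * c := by
  obtain ⟨z, hz, hz0, hz1⟩ := hsol
  have hcδ : 0 < c / δ := by positivity
  -- The height bound `X = (c / δ) ^ γ` is the one for which `c X ^ (-1/γ) = δ`.
  rw [neg_div, one_div, rpow_neg (by positivity), rpow_goldenRatio_rpow hcδ.le, inv_div,
    mul_div_cancel₀ _ hc.ne'] at hz1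
  have hf : ∀ x : Fin 3 → A, x ≠ 0 → simError φ ξ x ≤ δ → 1 ≤ ‖φ (x 0)‖ := fun x hx h =>
    hφ _ (apply_zero_ne_zero_of_simError_lt_one hφ hx (h.trans_lt hδ1))
  obtain ⟨x, ⟨hx, hxδ⟩, hmin⟩ := exists_forall_le_two_mul
    (S := {x : Fin 3 → A | x ≠ 0 ∧ simError φ ξ x ≤ δ}) (f := fun x => ‖φ (x 0)‖) ⟨z, hz, hz1⟩
    fun x hx => hf x hx.1 hx.2
  -- Removing the content `d` increases neither the height nor the error, since `|d| ≥ 1`.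
  obtain ⟨d, y, hd, rfl, hy⟩ := exists_primitive hx
  have hyx : ‖φ (y 0)‖ ≤ ‖φ ((d • y) 0)‖ := by
    rw [Pi.smul_apply, smul_eq_mul, map_mul, norm_mul]
    exact le_mul_of_one_le_left (norm_nonneg _) (hφ d hd)
  have hyδ : simError φ ξ y ≤ δ := by
    refine le_trans ?_ hxδ
    rw [simError_smul]
    exact le_mul_of_one_le_left (simError_nonneg _ _ _) (hφ d hd)
  refine ⟨y, ⟨hy, fun w hw hwy => hyx.trans (hmin w ⟨hw, hwy.trans hyδ⟩)⟩, hyδ, ?_⟩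
  have h2 : ‖φ (y 0)‖ ≤ 2 * (c / δ) ^ goldenRatio :=
    hyx.trans ((hmin z ⟨hz, hz1⟩).trans (by gcongr))
  have h3 : ‖φ (y 0)‖ ^ goldenRatio⁻¹ ≤ 2 * (c / δ) := by
    refine (rpow_le_rpow (norm_nonneg _) h2 (by positivity)).trans ?_
    rw [mul_rpow (by norm_num) (by positivity), rpow_goldenRatio_rpow hcδ.le]
    gcongr
    calc (2 : ℝ) ^ goldenRatio⁻¹ ≤ 2 ^ (1 : ℝ) :=
          rpow_le_rpow_of_exponent_le one_le_two inv_goldenRatio_le_one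
      _ = 2 := rpow_one 2
  calc _ ≤ 2 * (c / δ) * δ := by gcongr
    _ = 2 * c := by field_simp

/-- A substitute for the sequence of minimal points. -/
theorem exists_nearMinimal_seq (hφ : ∀ a, a ≠ 0 → 1 ≤ ‖φ a‖)
    (hξ : ∀ a b c : A, φ a + φ b * ξ + φ c * ξ ^ 2 = 0 → a = 0 ∧ b = 0 ∧ c = 0)
    {c B : ℝ} (hc : 0 < c)
    (hsol : ∀ X, B ≤ X → ∃ x : Fin 3 → A, x ≠ 0 ∧ ‖φ (x 0)‖ ≤ X ∧
      simError φ ξ x ≤ c * X ^ (-1 / goldenRatio)) :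
    ∃ x : ℕ → Fin 3 → A, ∀ i, IsNearMinimal φ ξ (x i) ∧ simError φ ξ (x i) < 1 ∧
      simError φ ξ (x (i + 1)) ≤ simError φ ξ (x i) / 2 ∧
      simError φ ξ (x i) * ‖φ (x (i + 1) 0)‖ ^ goldenRatio⁻¹ ≤ 4 * c := by
  obtain ⟨B', hB1, hB'⟩ : ∃ B', 1 ≤ B' ∧ B ≤ B' := ⟨max 1 B, le_max_left _ _, le_max_right _ _⟩
  have hB0 : 0 < B' := one_pos.trans_le hB1
  -- The second bound on `δ₀` ensures `(c / δ) ^ γ ≥ B'` for all `δ ≤ δ₀`.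
  obtain ⟨δ₀, hδ₀, hδ₁, hδB⟩ : ∃ δ₀, 0 < δ₀ ∧ δ₀ < 1 ∧ δ₀ ≤ c * (B' ^ goldenRatio⁻¹)⁻¹ :=
    ⟨min (1 / 2) (c * (B' ^ goldenRatio⁻¹)⁻¹), by positivity,
      (min_le_left _ _).trans_lt (by norm_num), min_le_right _ _⟩
  have step : ∀ δ, 0 < δ → δ ≤ δ₀ → ∃ x, IsNearMinimal φ ξ x ∧ simError φ ξ x ≤ δ ∧
      ‖φ (x 0)‖ ^ goldenRatio⁻¹ * δ ≤ 2 * c := by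
    intro δ hδ hle
    refine exists_isNearMinimal hφ hc hδ (hle.trans_lt hδ₁) (hsol _ (hB'.trans ?_))
    have h1 : B' ^ goldenRatio⁻¹ ≤ c / δ := by
      rw [le_div_iff₀ hδ, mul_comm, ← le_div_iff₀ (by positivity)]
      exact hle.trans hδB
    calc B' = (B' ^ goldenRatio⁻¹) ^ goldenRatio := by
          rw [← rpow_mul hB0.le, inv_mul_cancel₀ goldenRatio_pos.ne', rpow_one]
      _ ≤ _ := rpow_le_rpow (by positivity) h1 goldenRatio_pos.le
  have next : ∀ x : {x // IsNearMinimal φ ξ x ∧ simError φ ξ x ≤ δ₀},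
      ∃ y : {y // IsNearMinimal φ ξ y ∧ simError φ ξ y ≤ δ₀},
        simError φ ξ y.1 ≤ simError φ ξ x.1 / 2 ∧
        simError φ ξ x.1 * ‖φ (y.1 0)‖ ^ goldenRatio⁻¹ ≤ 4 * c := by
    rintro ⟨x, hx, hxδ⟩
    have hpos := simError_pos hξ hx.1.ne_zero
    -- Asking for half the error of `x` makes errors decrease geometrically, and turns the constant
    -- `2 * c` into `4 * c`.
    obtain ⟨y, hy, hyx, hyc⟩ := step (simError φ ξ x / 2) (by positivity) (by linarith)
    exact ⟨⟨y, hy, by linarith⟩, hyx, by linarith⟩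
  obtain ⟨x₀, hx₀, hx₀', -⟩ := step δ₀ hδ₀ le_rfl
  choose f hf using next
  let s : ℕ → {x // IsNearMinimal φ ξ x ∧ simError φ ξ x ≤ δ₀} :=
    fun i => Nat.rec ⟨x₀, hx₀, hx₀'⟩ (fun _ x => f x) i
  exact ⟨fun i => (s i).1, fun i => ⟨(s i).2.1, (s i).2.2.trans_lt hδ₁, (hf (s i)).1,
    (hf (s i)).2⟩⟩

/-- A point of small error preceded by a point not proportional to it does not lie on the conic
`x₀ x₂ = x₁²`. -/
theorem symm_det_ne_zero (hφ : ∀ a, a ≠ 0 → 1 ≤ ‖φ a‖) {x y : Fin 3 → A}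
    (hx : x 0 ≠ 0) (hxy : simError φ ξ x ≤ simError φ ξ y) (hn : ‖φ (y 0)‖ ≤ 2 * ‖φ (x 0)‖) {c : ℝ}
    (hc : 12 * c < 1) (h : simError φ ξ y * ‖φ (x 0)‖ ^ goldenRatio⁻¹ ≤ 4 * c)
    (hprop : ¬ (x 0 * y 1 = x 1 * y 0 ∧ x 0 * y 2 = x 2 * y 0)) :
    x 0 * x 2 - x 1 ^ 2 ≠ 0 := by
  intro h0
  obtain ⟨m, p, q, e0, e1, e2⟩ := exists_eq_mul_sq hx (sub_eq_zero.1 h0)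
  have hX := hφ _ hx
  set X := ‖φ (x 0)‖ with hXdef
  have hX0 : 0 < X := one_pos.trans_le hX
  have hm : m ≠ 0 := by rintro rfl; simp [e0] at hx
  have hp : p ≠ 0 := by rintro rfl; simp [e0] at hx
  have hL := simError_nonneg φ ξ x
  have hy0 := simError_nonneg φ ξ y
  have hbound : X * simError φ ξ y + ‖φ (y 0)‖ * simError φ ξ x ≤ 12 * c * X ^ (1 / 2 : ℝ) := by
    have h1 : simError φ ξ y * X ^ (1 / 2 : ℝ) ≤ 4 * c :=
      (mul_le_mul_of_nonneg_left
        (rpow_le_rpow_of_exponent_le hX half_le_inv_goldenRatio) hy0).trans h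
    have h2 : X ^ (1 / 2 : ℝ) * X ^ (1 / 2 : ℝ) = X := by
      rw [← rpow_add hX0]; norm_num
    calc _ ≤ X * simError φ ξ y + 2 * X * simError φ ξ y := by gcongr
      _ = 3 * (simError φ ξ y * X ^ (1 / 2 : ℝ)) * X ^ (1 / 2 : ℝ) := by
        linear_combination (-3 * simError φ ξ y) * h2
      _ ≤ 3 * (4 * c) * X ^ (1 / 2 : ℝ) := by gcongr
      _ = _ := by ring
  have hmp : X ^ (1 / 2 : ℝ) ≤ ‖φ (m * p)‖ := by
    rw [← sqrt_eq_rpow]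
    refine sqrt_le_iff.2 ⟨norm_nonneg _, ?_⟩
    rw [← norm_pow, ← map_pow, show (m * p) ^ 2 = m * (x 0) by rw [e0]; ring, map_mul, norm_mul]
    exact le_mul_of_one_le_left (norm_nonneg _) (hφ m hm)
  -- Minors of `x` and `y` have size at most `12 c X^(1/2) < X^(1/2)`, because `1/γ ≥ 1/2`; a
  -- multiple of `m * p` that small must vanish.
  have hzero : ∀ t : A, ‖φ (m * p * t)‖ ≤ X * simError φ ξ y + ‖φ (y 0)‖ * simError φ ξ x →
      t = 0 := by
    intro t ht
    by_contra hne
    have h1 := hφ t hne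
    rw [map_mul, norm_mul] at ht
    have h2 : X ^ (1 / 2 : ℝ) * 1 ≤ ‖φ (m * p)‖ * ‖φ t‖ := by gcongr
    have h3 : 0 < X ^ (1 / 2 : ℝ) := by positivity
    nlinarith
  have h1 : p * y 1 - q * y 0 = 0 := hzero _ (by
    convert norm_minor_one_le φ ξ x y using 3
    rw [e0, e1]; ring)
  -- The second minor is `m p (p y₂ - q y₁) + m q (p y₁ - q y₀)`, and the last term vanishes by
  -- `h1`.
  have h2 : p * y 2 - q * y 1 = 0 := hzero _ (by
    convert norm_minor_two_le φ ξ x y using 3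
    rw [e0, e2]; linear_combination (-m * q) * h1)
  refine hprop ⟨?_, ?_⟩
  · rw [e0, e1]; linear_combination m * p * h1
  · rw [e0, e2]; linear_combination m * p * h2 + m * q * h1

theorem not_uniformly_approximable (hφ : ∀ a, a ≠ 0 → 1 ≤ ‖φ a‖)
    (hξ : ∀ a b c : A, φ a + φ b * ξ + φ c * ξ ^ 2 = 0 → a = 0 ∧ b = 0 ∧ c = 0) :
    ∃ c : ℝ, 0 < c ∧ ∀ B : ℝ, ∃ X : ℝ, B ≤ X ∧ ¬ ∃ x : Fin 3 → A, x ≠ 0 ∧ ‖φ (x 0)‖ ≤ X ∧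
      simError φ ξ x ≤ c * X ^ (-1 / goldenRatio) := by
  obtain ⟨C, hC⟩ : ∃ C, C = 2 + 2 * ‖ξ‖ := ⟨_, rfl⟩
  have hC2 : 2 ≤ C := by rw [hC]; linarith [norm_nonneg ξ]
  -- Three smallness conditions are met: `12 c < 1` for `symm_det_ne_zero`, `4 c C ≤ 1` for `hYX`,
  -- and `14 (4 c)² < 1` for the final contradiction.
  obtain ⟨c, hc, hcC⟩ : ∃ c : ℝ, 0 < c ∧ c * C = 1 / 100 :=
    ⟨1 / (100 * C), by positivity, by field_simp⟩
  have hc1 : c ≤ 1 / 200 := by nlinarith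
  refine ⟨c, hc, ?_⟩
  by_contra! hcon
  obtain ⟨B, hB⟩ := hcon
  obtain ⟨x, hx⟩ := exists_nearMinimal_seq hφ hξ hc hB
  have hne : ∀ i, x i ≠ 0 := fun i => (hx i).1.1.ne_zero
  have hx0 : ∀ i, x i 0 ≠ 0 := fun i => apply_zero_ne_zero_of_simError_lt_one hφ (hne i) (hx i).2.1
  have hpos : ∀ i, 0 < simError φ ξ (x i) := fun i => simError_pos hξ (hne i)
  have hanti : ∀ i, simError φ ξ (x (i + 1)) < simError φ ξ (x i) := fun i => by
    linarith [(hx i).2.2.1, hpos i]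
  have hmono : ∀ i, ‖φ (x i 0)‖ ≤ 2 * ‖φ (x (i + 1) 0)‖ := fun i =>
    (hx i).1.2 _ (hne _) (hanti i).le
  have hgeom : ∀ i, simError φ ξ (x i) ≤ (1 / 2) ^ i := by
    intro i
    induction i with
    | zero => simpa using (hx 0).2.1.le
    | succ i ih => rw [pow_succ]; linarith [(hx i).2.2.1]
  have hlim : Tendsto (fun i => simError φ ξ (x i)) atTop (𝓝 0) :=
    squeeze_zero (fun i => (hpos i).le) hgeom
      (tendsto_pow_atTop_nhds_zero_of_lt_one (by norm_num) (by norm_num))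
  have hprop : ∀ i, ¬ (x i 0 * x (i + 1) 1 = x i 1 * x (i + 1) 0 ∧
      x i 0 * x (i + 1) 2 = x i 2 * x (i + 1) 0) := by
    rintro i ⟨h1, h2⟩
    obtain ⟨d, hd⟩ := (hx i).1.1.exists_eq_smul (hx0 i) (y := x (i + 1)) fun j => by
      fin_cases j
      exacts [rfl, h1, h2]
    have hd0 : d ≠ 0 := by rintro rfl; exact hne (i + 1) (by rw [hd, zero_smul])
    have := hanti i
    rw [hd, simError_smul] at this
    exact this.not_ge (le_mul_of_one_le_left (hpos i).le (hφ d hd0))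
  obtain ⟨i, hi⟩ := exists_tripleDet_ne_zero hφ hξ hx0 hlim hprop
  have hdet3 := (hφ _ hi).trans (norm_tripleDet_le φ ξ _ _ _)
  have hdet2 := (hφ _ (symm_det_ne_zero hφ (hx0 (i + 1)) (hanti i).le (hmono i) (c := c)
    (by linarith) (hx i).2.2.2 fun h => hprop i
      ⟨by linear_combination -h.1, by linear_combination -h.2⟩)).trans
    (norm_symm_det_le φ ξ _ (hx _).2.1.le (hφ _ (hx0 _)))
  have hL0 := (hx i).2.2.2
  have hL1 := (hx (i + 1)).2.2.2
  have hm0 := hmono i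
  have hm1 := hmono (i + 1)
  have ha0 := hanti i
  have ha1 := hanti (i + 1)
  have hp0 := hpos i
  have hp1 := hpos (i + 1)
  have hp2 := hpos (i + 2)
  have hX := hφ _ (hx0 (i + 1))
  have hY := hφ _ (hx0 (i + 2))
  rw [show i + 1 + 1 = i + 2 from rfl] at *
  rw [← hC] at hdet2
  generalize simError φ ξ (x i) = l0, simError φ ξ (x (i + 1)) = l1,
    simError φ ξ (x (i + 2)) = l2, ‖φ (x i 0)‖ = W, ‖φ (x (i + 1) 0)‖ = X,
    ‖φ (x (i + 2) 0)‖ = Y at *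
  have hX0 : 0 < X := by linarith
  have hY0 : 0 < Y := by linarith
  -- Since `W ≤ 4 Y`, `X ≤ 2 Y` and `l2` is below both `l0` and `l1`, the three terms of the
  -- determinant bound total at most `2 (4 + 2 + 1) Y l1 l0`.
  have h3 : 1 ≤ 14 * (Y * l1 * l0) := by
    have e1 : W * l1 * l2 ≤ 4 * Y * l1 * l0 := by
      gcongr <;> linarith
    have e2 : X * l0 * l2 ≤ 2 * Y * l0 * l1 := by gcongr
    linarith
  have hYX : Y ^ goldenRatio⁻¹ ≤ X := by
    calc Y ^ goldenRatio⁻¹ ≤ Y ^ goldenRatio⁻¹ * (C * (X * l1)) :=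
          le_mul_of_one_le_right (by positivity) hdet2
      _ = C * X * (l1 * Y ^ goldenRatio⁻¹) := by ring
      _ ≤ C * X * (4 * c) := by gcongr
      _ = X * (4 * (c * C)) := by ring
      _ ≤ X := by rw [hcC]; linarith
  have hYsplit : Y = Y ^ goldenRatio⁻¹ * (Y ^ goldenRatio⁻¹) ^ goldenRatio⁻¹ := by
    rw [← rpow_mul hY0.le, ← rpow_add hY0, add_comm, inv_goldenRatio_sq_add, rpow_one]
  have hfin : Y * l1 * l0 ≤ (4 * c) * (4 * c) := by
    calc Y * l1 * l0 = (l1 * Y ^ goldenRatio⁻¹) * (l0 * (Y ^ goldenRatio⁻¹) ^ goldenRatio⁻¹) := by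
          conv_lhs => rw [hYsplit]
          ring
      _ ≤ (l1 * Y ^ goldenRatio⁻¹) * (l0 * X ^ goldenRatio⁻¹) := by gcongr
      _ ≤ _ := by gcongr
  nlinarith

end LowerBound

/-! ### Continuants of the Fibonacci word and the symmetric matrices they contain. -/

section ContinuantMatrices

open Matrix

variable {R : Type*} [CommRing R]

/-- The matrix `!![u, 1; 1, 0]` attached to a partial quotient. -/
def quotMatrix (u : R) : Matrix (Fin 2) (Fin 2) R := !![u, 1; 1, 0]

/-- The denominators of the convergents of `[0, u 0, u 1, ...]`. -/
def cfDen (u : ℕ → R) : ℕ → R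
  | 0 => 1
  | 1 => u 0
  | n + 2 => u (n + 1) * cfDen u (n + 1) + cfDen u n

/-- The numerators of the convergents of `[0, u 0, u 1, ...]`. -/
def cfNum (u : ℕ → R) : ℕ → R
  | 0 => 0
  | 1 => 1
  | n + 2 => u (n + 1) * cfNum u (n + 1) + cfNum u n

theorem map_cfDen {S : Type*} [CommRing S] (φ : R →+* S) (u : ℕ → R) :
    ∀ n, φ (cfDen u n) = cfDen (φ ∘ u) n
  | 0 => map_one φ
  | 1 => rfl
  | n + 2 => by simp only [cfDen, map_add, map_mul, map_cfDen, Function.comp]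

theorem map_cfNum {S : Type*} [CommRing S] (φ : R →+* S) (u : ℕ → R) :
    ∀ n, φ (cfNum u n) = cfNum (φ ∘ u) n
  | 0 => map_zero φ
  | 1 => map_one φ
  | n + 2 => by simp only [cfNum, map_add, map_mul, map_cfNum, Function.comp]

theorem cfNum_mul_cfDen_sub (u : ℕ → R) (n : ℕ) :
    cfNum u (n + 1) * cfDen u n - cfNum u n * cfDen u (n + 1) = (-1) ^ n := by
  induction n with
  | zero => simp [cfNum, cfDen]
  | succ n ih => rw [cfNum, cfDen, pow_succ, ← ih]; ring

theorem prod_quotMatrix_range (u : ℕ → R) (n : ℕ) :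
    (((List.range (n + 1)).map u).map quotMatrix).prod =
      !![cfDen u (n + 1), cfDen u n; cfNum u (n + 1), cfNum u n] := by
  induction n with
  | zero => simp [quotMatrix, cfDen, cfNum]
  | succ n ih =>
    rw [List.range_succ, List.map_append, List.map_append, List.prod_append, ih]
    simp [quotMatrix, cfDen, cfNum, mul_comm]

theorem map_fibLetter_range {α : Type*} (a b : α) (n : ℕ) :
    (List.range (fibWord a b n).length).map (fibLetter a b) = fibWord a b n := by
  refine List.ext_getElem (by simp) fun i h1 h2 => ?_
  rw [List.getElem_map, List.getElem_range, fibLetter_eq a b n i h2]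

theorem fibWord_map {α β : Type*} (f : α → β) (a b : α) :
    ∀ n, (fibWord a b n).map f = fibWord (f a) (f b) n
  | 0 => rfl
  | 1 => rfl
  | n + 2 => by simp only [fibWord, List.map_append, fibWord_map]

theorem map_fibLetter {α β : Type*} (f : α → β) (a b : α) (n : ℕ) :
    f (fibLetter a b n) = fibLetter (f a) (f b) n := by
  simp only [fibLetter, ← fibWord_map f, List.getElem_map]

theorem mem_fibWord {α : Type*} {a b : α} :
    ∀ {n : ℕ} {c : α}, c ∈ fibWord a b n → c = a ∨ c = b
  | 0, c, h => by simp_all [fibWord]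
  | 1, c, h => by simp_all [fibWord]
  | n + 2, c, h => by
    rw [fibWord, List.mem_append] at h
    exact h.elim mem_fibWord mem_fibWord

theorem fibLetter_eq_or {α : Type*} (a b : α) (n : ℕ) :
    fibLetter a b n = a ∨ fibLetter a b n = b :=
  mem_fibWord (List.getElem_mem _)

/-- The matrix of the last two letters of `fibWord a b n`. -/
def fibEnd (a b : R) : ℕ → Matrix (Fin 2) (Fin 2) R
  | 0 => quotMatrix b * quotMatrix a
  | 1 => quotMatrix a * quotMatrix b
  | n + 2 => fibEnd a b n

/-- The matrix of `fibWord a b n` deprived of its last two letters, which is a palindrome. -/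
def fibSym (a b : R) : ℕ → Matrix (Fin 2) (Fin 2) R
  -- The word `a` is too short to lose `ba`; the formal result is the inverse of `quotMatrix b`,
  -- which makes `prod_fibWord` hold from index `0`.
  | 0 => !![0, 1; 1, -b]
  | 1 => 1
  | n + 2 => fibSym a b (n + 1) * fibEnd a b (n + 1) * fibSym a b n

theorem fibEnd_transpose (a b : R) : ∀ n, (fibEnd a b n)ᵀ = fibEnd a b (n + 1)
  | 0 => by simp [fibEnd, quotMatrix, ← Matrix.ext_iff, mul_comm]
  | 1 => by simp [fibEnd, quotMatrix, ← Matrix.ext_iff, mul_comm]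
  | n + 2 => fibEnd_transpose a b n

theorem det_fibEnd (a b : R) : ∀ n, (fibEnd a b n).det = 1
  | 0 => by simp [fibEnd, quotMatrix, Matrix.det_fin_two]
  | 1 => by simp [fibEnd, quotMatrix, Matrix.det_fin_two]
  | n + 2 => det_fibEnd a b n

theorem det_fibSym_sq (a b : R) : ∀ n, (fibSym a b n).det ^ 2 = 1
  | 0 => by simp [fibSym, Matrix.det_fin_two]
  | 1 => by simp [fibSym]
  | n + 2 => by
    rw [fibSym, det_mul, det_mul, det_fibEnd, mul_one, mul_pow, det_fibSym_sq, det_fibSym_sq,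
      mul_one]

theorem prod_fibWord (a b : R) :
    ∀ n, ((fibWord a b n).map quotMatrix).prod = fibSym a b n * fibEnd a b n
  | 0 => by simp [fibWord, fibSym, fibEnd, quotMatrix]
  | 1 => by simp [fibWord, fibSym, fibEnd]
  | n + 2 => by
    rw [fibWord, List.map_append, List.prod_append, prod_fibWord, prod_fibWord, fibSym, fibEnd]
    simp only [Matrix.mul_assoc]

/-- With `S`, `E` for `fibSym`, `fibEnd`: the symmetry of `S (n + 2)` also gives `S (n + 2) = S n *
E (n + 2) * S (n + 1)`. Inserting this in the transpose of `S (n + 3)` gives back `S (n + 3)`, so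
three consecutive indices are carried along. -/
theorem fibSym_transpose_aux (a b : R) (n : ℕ) : (fibSym a b n)ᵀ = fibSym a b n ∧
    (fibSym a b (n + 1))ᵀ = fibSym a b (n + 1) ∧ (fibSym a b (n + 2))ᵀ = fibSym a b (n + 2) := by
  induction n with
  | zero => simp [fibSym, fibEnd, quotMatrix, ← Matrix.ext_iff]
  | succ n ih =>
    refine ⟨ih.2.1, ih.2.2, ?_⟩
    obtain ⟨h0, h1, h2⟩ := ih
    have e : (fibEnd a b (n + 2))ᵀ = fibEnd a b (n + 1) := (fibEnd_transpose a b (n + 2))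
    have e' : (fibEnd a b (n + 1))ᵀ = fibEnd a b (n + 2) := fibEnd_transpose a b (n + 1)
    have h3 : fibSym a b (n + 2) = fibSym a b n * fibEnd a b (n + 2) * fibSym a b (n + 1) := by
      conv_lhs => rw [← h2, fibSym]
      rw [transpose_mul, transpose_mul, h0, h1, e', Matrix.mul_assoc]
    rw [show n + 1 + 2 = n + 3 from rfl, fibSym, transpose_mul, transpose_mul, h1, h2, e]
    conv_lhs => rw [h3]
    conv_rhs => rw [fibSym]
    simp only [Matrix.mul_assoc]

theorem fibSym_transpose (a b : R) (n : ℕ) : (fibSym a b n)ᵀ = fibSym a b n :=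
  (fibSym_transpose_aux a b n).1

/-- The point attached to the symmetric matrix `fibSym a b n`. -/
def fibPoint (a b : R) (n : ℕ) : Fin 3 → R :=
  ![fibSym a b n 0 0, fibSym a b n 0 1, fibSym a b n 1 1]

theorem fibEnd_sub_ne_zero {a b : R} (hab : a ≠ b) :
    ∀ n, fibEnd a b n 0 1 - fibEnd a b n 1 0 ≠ 0
  | 0 => by simpa [fibEnd, quotMatrix, sub_eq_zero] using hab.symm
  | 1 => by simpa [fibEnd, quotMatrix, sub_eq_zero] using hab
  | n + 2 => fibEnd_sub_ne_zero hab n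

theorem fibSym_one_zero (a b : R) (n : ℕ) : fibSym a b n 1 0 = fibSym a b n 0 1 := by
  conv_rhs => rw [← fibSym_transpose]
  rfl

/-- Substitute the recursion for the third matrix. Its symmetry (`h`) eliminates everything but the
antisymmetric part of `fibEnd`, which is `±(a - b)`. -/
theorem tripleDet_fibPoint (a b : R) (n : ℕ) :
    tripleDet (fibPoint a b n) (fibPoint a b (n + 1)) (fibPoint a b (n + 2)) =
      - ((fibSym a b n).det * (fibSym a b (n + 1)).det *
        (fibEnd a b (n + 1) 0 1 - fibEnd a b (n + 1) 1 0)) := by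
  have h := fibSym_one_zero a b (n + 2)
  have hx := fibSym_one_zero a b n
  have hy := fibSym_one_zero a b (n + 1)
  simp only [tripleDet, fibPoint, fibSym, Matrix.det_fin_two, Matrix.mul_apply, Fin.sum_univ_two,
    Matrix.cons_val_zero, Matrix.cons_val_one, Matrix.cons_val, hx, hy] at h ⊢
  linear_combination (fibSym a b n 0 1 * fibSym a b (n + 1) 0 1 -
    fibSym a b n 1 1 * fibSym a b (n + 1) 0 0) * h

theorem tripleDet_fibPoint_ne_zero [IsDomain R] {a b : R} (hab : a ≠ b) (n : ℕ) :
    tripleDet (fibPoint a b n) (fibPoint a b (n + 1)) (fibPoint a b (n + 2)) ≠ 0 := by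
  have h : ∀ n, (fibSym a b n).det ≠ 0 := fun n h => by
    have := det_fibSym_sq a b n
    rw [h] at this
    simp at this
  rw [tripleDet_fibPoint]
  exact neg_ne_zero.2 (mul_ne_zero (mul_ne_zero (h _) (h _)) (fibEnd_sub_ne_zero hab _))

theorem fibPoint_ne_zero [IsDomain R] {a b : R} (hab : a ≠ b) (n : ℕ) : fibPoint a b n ≠ 0 := by
  intro h
  have := tripleDet_fibPoint_ne_zero hab n
  simp [h, tripleDet] at this

theorem fibSym_eq_mul_adjugate (a b : R) (n : ℕ) :
    fibSym a b n = ((fibWord a b n).map quotMatrix).prod * (fibEnd a b n).adjugate := by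
  rw [prod_fibWord, Matrix.mul_assoc, mul_adjugate, det_fibEnd, one_smul, Matrix.mul_one]

theorem prod_fibWord_eq (a b : R) {n k : ℕ} (hk : (fibWord a b n).length = k + 1) :
    ((fibWord a b n).map quotMatrix).prod =
      !![cfDen (fibLetter a b) (k + 1), cfDen (fibLetter a b) k;
        cfNum (fibLetter a b) (k + 1), cfNum (fibLetter a b) k] := by
  rw [← map_fibLetter_range, hk, prod_quotMatrix_range]

end ContinuantMatrices

/-! ### Convergence of continued fractions with partial quotients of norm at least `4`. -/

section ContinuedFractionEstimates

variable {F : Type*} [NormedField F] {u : ℕ → F}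

theorem cfDen_growth (hu : ∀ n, 4 ≤ ‖u n‖) (n : ℕ) :
    1 ≤ ‖cfDen u n‖ ∧ 3 * ‖cfDen u n‖ ≤ ‖cfDen u (n + 1)‖ := by
  induction n with
  | zero => simpa [cfDen] using (by linarith [hu 0] : (3 : ℝ) ≤ ‖u 0‖)
  | succ n ih =>
    obtain ⟨h1, h2⟩ := ih
    refine ⟨by linarith, ?_⟩
    have h3 := norm_sub_le_norm_add (u (n + 1) * cfDen u (n + 1)) (cfDen u n)
    rw [norm_mul] at h3
    rw [cfDen]
    nlinarith [hu (n + 1)]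

theorem pow_mul_le_norm_cfDen (hu : ∀ n, 4 ≤ ‖u n‖) (n k : ℕ) :
    3 ^ k * ‖cfDen u n‖ ≤ ‖cfDen u (n + k)‖ := by
  induction k with
  | zero => simp
  | succ k ih =>
    have := (cfDen_growth hu (n + k)).2
    rw [← add_assoc, pow_succ]
    linarith

theorem cfDen_ne_zero (hu : ∀ n, 4 ≤ ‖u n‖) (n : ℕ) : cfDen u n ≠ 0 :=
  norm_pos_iff.1 (one_pos.trans_le (cfDen_growth hu n).1)

theorem dist_convergents (hu : ∀ n, 4 ≤ ‖u n‖) (n : ℕ) :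
    dist (cfNum u n / cfDen u n) (cfNum u (n + 1) / cfDen u (n + 1)) =
      1 / (‖cfDen u n‖ * ‖cfDen u (n + 1)‖) := by
  have h0 := cfDen_ne_zero hu n
  have h1 := cfDen_ne_zero hu (n + 1)
  rw [dist_comm, dist_eq_norm, div_sub_div _ _ h1 h0, norm_div, norm_mul,
    mul_comm (cfDen u (n + 1)) (cfNum u n), cfNum_mul_cfDen_sub, norm_pow, norm_neg, norm_one,
    one_pow, mul_comm]

theorem dist_convergents_shift (hu : ∀ n, 4 ≤ ‖u n‖) (n k : ℕ) :
    dist (cfNum u (n + k) / cfDen u (n + k)) (cfNum u (n + (k + 1)) / cfDen u (n + (k + 1))) ≤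
      1 / (‖cfDen u n‖ * ‖cfDen u (n + 1)‖) * (1 / 9) ^ k := by
  have h0 := (cfDen_growth hu n).1
  have h1 := (cfDen_growth hu (n + 1)).1
  have h2 := pow_mul_le_norm_cfDen hu n k
  have h3 := pow_mul_le_norm_cfDen hu (n + 1) k
  rw [add_right_comm] at h3
  rw [← add_assoc, dist_convergents hu, one_div_pow, one_div_mul_one_div]
  refine one_div_le_one_div_of_le (by positivity) ?_
  calc ‖cfDen u n‖ * ‖cfDen u (n + 1)‖ * 9 ^ k
      = (3 ^ k * ‖cfDen u n‖) * (3 ^ k * ‖cfDen u (n + 1)‖) := by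
        rw [show (9 : ℝ) = 3 * 3 by norm_num, mul_pow]; ring
    _ ≤ _ := by gcongr

theorem exists_limit_convergents [CompleteSpace F] (hu : ∀ n, 4 ≤ ‖u n‖) :
    ∃ ξ, Tendsto (fun n => cfNum u n / cfDen u n) atTop (𝓝 ξ) := by
  refine cauchySeq_tendsto_of_complete (cauchySeq_of_le_geometric (1 / 9)
    (1 / (‖cfDen u 0‖ * ‖cfDen u 1‖)) (by norm_num) fun n => ?_)
  simpa using dist_convergents_shift hu 0 n

theorem dist_convergent_limit (hu : ∀ n, 4 ≤ ‖u n‖) {ξ : F}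
    (hξ : Tendsto (fun n => cfNum u n / cfDen u n) atTop (𝓝 ξ)) (n : ℕ) :
    dist (cfNum u n / cfDen u n) ξ ≤ 9 / 8 * (1 / (‖cfDen u n‖ * ‖cfDen u (n + 1)‖)) := by
  have := dist_le_of_le_geometric_of_tendsto₀ (1 / 9) _ (by norm_num)
    (dist_convergents_shift hu n) (a := ξ) (by
      simpa only [add_comm n] using (tendsto_add_atTop_iff_nat n).2 hξ)
  refine this.trans_eq ?_
  rw [div_eq_mul_inv, mul_comm]
  norm_num

theorem norm_cfDen_mul_sub_le (hu : ∀ n, 4 ≤ ‖u n‖) {ξ : F}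
    (hξ : Tendsto (fun n => cfNum u n / cfDen u n) atTop (𝓝 ξ)) (n : ℕ) :
    ‖cfDen u n * ξ - cfNum u n‖ ≤ 2 / ‖cfDen u (n + 1)‖ := by
  have h0 := cfDen_ne_zero hu n
  have h := dist_convergent_limit hu hξ n
  have p0 := (cfDen_growth hu n).1
  have p1 := (cfDen_growth hu (n + 1)).1
  have e : cfDen u n * ξ - cfNum u n = cfDen u n * (ξ - cfNum u n / cfDen u n) := by
    field_simp
  rw [dist_comm, dist_eq_norm] at h
  rw [e, norm_mul]
  calc _ ≤ ‖cfDen u n‖ * (9 / 8 * (1 / (‖cfDen u n‖ * ‖cfDen u (n + 1)‖))) := by gcongr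
    _ = (9 / 8) / ‖cfDen u (n + 1)‖ := by field_simp
    _ ≤ _ := by gcongr; norm_num

theorem norm_cfNum_le [CompleteSpace F] (hu : ∀ n, 4 ≤ ‖u n‖) (n : ℕ) :
    ‖cfNum u n‖ ≤ ‖cfDen u n‖ := by
  obtain ⟨ξ, hξ⟩ := exists_limit_convergents hu
  have bound : ∀ n, dist (cfNum u n / cfDen u n) ξ ≤ 1 / 2 := by
    -- All convergents lie within `1/2` of the limit and the zeroth one is `0`, so each has norm at
    -- most `1`.
    intro n
    refine (dist_convergent_limit hu hξ n).trans ?_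
    have p0 := cfDen_growth hu n
    have : 1 / (‖cfDen u n‖ * ‖cfDen u (n + 1)‖) ≤ 1 / 3 := by
      refine one_div_le_one_div_of_le (by norm_num) ?_
      nlinarith
    linarith
  have h0 := bound 0
  have h := dist_triangle_right (cfNum u n / cfDen u n) (cfNum u 0 / cfDen u 0) ξ
  have hn := bound n
  rw [cfNum, zero_div, dist_zero_right, norm_div] at h
  have p0 := (cfDen_growth hu n).1
  have : ‖cfNum u n‖ / ‖cfDen u n‖ ≤ 1 := by
    rw [cfNum, zero_div] at h0
    linarith
  rwa [div_le_one (by linarith)] at this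

theorem dens_eq_cfDen (u : ℕ → F) : ∀ n, (⟨0, Stream'.Seq.ofStream (fun n : ℕ =>
    (⟨1, u n⟩ : GenContFract.Pair F))⟩ : GenContFract F).dens n = cfDen u n
  | 0 => GenContFract.zeroth_den_eq_one
  | 1 => GenContFract.first_den_eq (gp := ⟨1, u 0⟩) rfl
  | n + 2 => by
    rw [GenContFract.dens_recurrence (gp := ⟨1, u (n + 1)⟩) rfl (dens_eq_cfDen u n)
      (dens_eq_cfDen u (n + 1)), cfDen, one_mul]

theorem nums_eq_cfNum (u : ℕ → F) : ∀ n, (⟨0, Stream'.Seq.ofStream (fun n : ℕ =>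
    (⟨1, u n⟩ : GenContFract.Pair F))⟩ : GenContFract F).nums n = cfNum u n
  | 0 => GenContFract.zeroth_num_eq_h
  | 1 => by
    rw [GenContFract.first_num_eq (gp := ⟨1, u 0⟩) rfl]
    simp [cfNum]
  | n + 2 => by
    rw [GenContFract.nums_recurrence (gp := ⟨1, u (n + 1)⟩) rfl (nums_eq_cfNum u n)
      (nums_eq_cfNum u (n + 1)), cfNum, one_mul]

theorem fibContFract_convs (a b : F) (n : ℕ) :
    (fibContFract a b).convs n = cfNum (fibLetter a b) n / cfDen (fibLetter a b) n := by
  rw [← dens_eq_cfDen, ← nums_eq_cfNum]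
  rfl

end ContinuedFractionEstimates

/-! ### From multiplicative growth of the heights to the exponent `1/γ`. -/

open Real in
/-- A sequence of reals satisfying `Q (n + 2) ≍ Q (n + 1) Q n` satisfies `Q (n + 1) ≪ Q n ^ γ`. -/
theorem exists_rpow_inv_goldenRatio_le {Q : ℕ → ℝ} (hQ : ∀ n, 1 ≤ Q n)
    (h1 : ∀ n, Q (n + 2) ≤ 2 * (Q (n + 1) * Q n)) (h2 : ∀ n, Q (n + 1) * Q n ≤ 2 * Q (n + 2)) :
    ∃ C, 0 < C ∧ ∀ n, Q (n + 1) ^ goldenRatio⁻¹ ≤ C * Q n := by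
  have hpos : ∀ n, 0 < Q n := fun n => one_pos.trans_le (hQ n)
  obtain ⟨θ, hθ⟩ : ∃ θ, θ = goldenRatio⁻¹ := ⟨_, rfl⟩
  have hθ0 : 0 < θ := by rw [hθ]; exact inv_pos.2 goldenRatio_pos
  have hθ1 : θ < 1 := by rw [hθ]; exact inv_lt_one_of_one_lt₀ one_lt_goldenRatio
  have hθ2 : θ * θ + θ = 1 := by rw [hθ]; exact inv_goldenRatio_sq_add
  have hlog2 : 0 < log 2 := log_pos one_lt_two
  have u1 : ∀ n, log (Q (n + 2)) ≤ log 2 + (log (Q (n + 1)) + log (Q n)) := fun n => by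
    have p1 := hpos (n + 1)
    have p0 := hpos n
    rw [← log_mul p1.ne' p0.ne', ← log_mul two_ne_zero (by positivity)]
    exact log_le_log (hpos _) (h1 n)
  have u2 : ∀ n, log (Q (n + 1)) + log (Q n) ≤ log 2 + log (Q (n + 2)) := fun n => by
    have p1 := hpos (n + 1)
    have p0 := hpos n
    have p2 := hpos (n + 2)
    rw [← log_mul p1.ne' p0.ne', ← log_mul two_ne_zero p2.ne']
    exact log_le_log (by positivity) (h2 n)
  -- The quantity `r_n = θ log Q_{n+1} - log Q_n` satisfies `r_{n+1} = θ ε_n - θ r_n` with `|ε_n| ≤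
  -- log 2`. As `θ < 1`, an interval `[-R, R]` with `θ (R + log 2) ≤ R` is stable.
  obtain ⟨R, hR0, hR1⟩ : ∃ R, |θ * log (Q 1) - log (Q 0)| ≤ R ∧ θ * (R + log 2) ≤ R := by
    refine ⟨|θ * log (Q 1) - log (Q 0)| + θ * log 2 / (1 - θ), ?_, ?_⟩
    · have : 0 < 1 - θ := by linarith
      have : 0 < θ * log 2 / (1 - θ) := by positivity
      linarith
    · have h : 0 < 1 - θ := by linarith
      have e : θ * log 2 / (1 - θ) * (1 - θ) = θ * log 2 := by field_simp
      nlinarith [abs_nonneg (θ * log (Q 1) - log (Q 0))]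
  have hr : ∀ n, |θ * log (Q (n + 1)) - log (Q n)| ≤ R := by
    intro n
    induction n with
    | zero => exact hR0
    | succ n ih =>
      rw [show n + 1 + 1 = n + 2 from rfl]
      have e : θ * log (Q (n + 2)) - log (Q (n + 1)) =
          θ * (log (Q (n + 2)) - log (Q (n + 1)) - log (Q n)) -
          θ * (θ * log (Q (n + 1)) - log (Q n)) := by
        linear_combination log (Q (n + 1)) * hθ2
      have h3 : |log (Q (n + 2)) - log (Q (n + 1)) - log (Q n)| ≤ log 2 :=
        abs_le.2 ⟨by linarith [u2 n], by linarith [u1 n]⟩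
      rw [e]
      refine (abs_sub _ _).trans ?_
      rw [abs_mul, abs_mul, abs_of_pos hθ0]
      nlinarith
  refine ⟨exp R, exp_pos R, fun n => ?_⟩
  rw [← hθ, rpow_def_of_pos (hpos _), ← exp_log (hpos n), ← exp_add, exp_le_exp]
  linarith [(abs_le.1 (hr n)).2]

open Real in
/-- Points whose heights satisfy `Q (n + 1) ≪ Q n ^ γ` and whose errors are `≪ 1 / Q n` provide
uniform solutions with exponent `1 / γ`. -/
theorem exists_uniform_of_seq {α : Type*} {f g : α → ℝ} {x : ℕ → α} {Q : ℕ → ℝ} {C D G : ℝ}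
    (hQ : ∀ n, 0 < Q n) (hQ' : Tendsto Q atTop atTop) (hC : 0 < C) (hD : 0 < D) (hG : 0 < G)
    (h1 : ∀ n, Q (n + 1) ^ goldenRatio⁻¹ ≤ C * Q n) (hf : ∀ n, f (x n) ≤ D * Q n)
    (hg : ∀ n, g (x n) ≤ G / Q n) :
    ∃ c, 0 < c ∧ ∃ X₀ : ℝ, ∀ X, X₀ ≤ X → ∃ n, f (x n) ≤ X ∧
      g (x n) ≤ c * X ^ (-1 / goldenRatio) := by
  refine ⟨G * C * D ^ goldenRatio⁻¹, by positivity, D * Q 0, fun X hX => ?_⟩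
  have hX0 : 0 < X := (mul_pos hD (hQ 0)).trans_le hX
  have hex : ∃ n, X < D * Q (n + 1) := by
    obtain ⟨n, hn⟩ := ((hQ'.comp (tendsto_add_atTop_nat 1)).eventually_gt_atTop (X / D)).exists
    exact ⟨n, by rwa [Function.comp, div_lt_iff₀' hD] at hn⟩
  classical
  have hn := Nat.find_spec hex
  -- Minimality of the index gives `D Q_n ≤ X < D Q_{n+1}` without `Q` being monotone; index `0` is
  -- covered by `X₀ = D * Q 0`.
  have hmin : D * Q (Nat.find hex) ≤ X := by
    rcases Nat.eq_zero_or_pos (Nat.find hex) with h | h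
    · rwa [h]
    · have := Nat.find_min hex (Nat.sub_one_lt h.ne')
      rwa [Nat.sub_add_cancel h, not_lt] at this
  generalize Nat.find hex = n at hn hmin
  refine ⟨n, (hf n).trans hmin, (hg n).trans ?_⟩
  have hq := hQ n
  have hq1 := hQ (n + 1)
  rw [neg_div, one_div, rpow_neg hX0.le, ← div_eq_mul_inv, div_le_div_iff₀ hq (by positivity)]
  calc G * X ^ goldenRatio⁻¹ ≤ G * (D * Q (n + 1)) ^ goldenRatio⁻¹ := by
        gcongr
    _ = G * (D ^ goldenRatio⁻¹ * Q (n + 1) ^ goldenRatio⁻¹) := by rw [mul_rpow hD.le hq1.le]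
    _ ≤ G * (D ^ goldenRatio⁻¹ * (C * Q n)) := by gcongr; exact h1 n
    _ = _ := by ring

/-! ### Part (b): the Fibonacci continued fraction attains the exponent. -/

section UpperBound

variable {A F : Type*} [CommRing A] [NormedField F] {φ : A →+* F} {ξ : F}

/-- If non-coplanar triples of points have arbitrarily small errors, then `1, ξ, ξ²` satisfy no
nontrivial linear relation. -/
theorem linear_relation_trivial_of_seq [IsDomain A] (hφ : ∀ a, a ≠ 0 → 1 ≤ ‖φ a‖) {x : ℕ → Fin 3 → A}
    (hlim : Tendsto (fun i => simError φ ξ (x i)) atTop (𝓝 0))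
    (hdet : ∀ i, tripleDet (x i) (x (i + 1)) (x (i + 2)) ≠ 0) (a b c : A)
    (h : φ a + φ b * ξ + φ c * ξ ^ 2 = 0) : a = 0 ∧ b = 0 ∧ c = 0 := by
  have hlim' := hlim.const_mul (‖φ b‖ + ‖φ c‖)
  rw [mul_zero] at hlim'
  obtain ⟨n, hn⟩ := eventually_atTop.1 (hlim'.eventually_lt_const one_pos)
  -- For large `i` this element of `A` has norm below `1`, hence vanishes; Cramer's rule on three
  -- consecutive points then finishes.
  have hz : ∀ i, n ≤ i → a * x i 0 + b * x i 1 + c * x i 2 = 0 := by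
    intro i hi
    by_contra hne
    refine (hφ _ hne).not_gt (lt_of_le_of_lt ?_ (hn i hi))
    have e : φ (a * x i 0 + b * x i 1 + c * x i 2) =
        -(φ b * (φ (x i 0) * ξ - φ (x i 1)) + φ c * (φ (x i 0) * ξ ^ 2 - φ (x i 2))) := by
      simp only [map_add, map_mul]
      linear_combination φ (x i 0) * h
    rw [e, norm_neg, add_mul]
    refine (norm_add_le _ _).trans ?_
    rw [norm_mul, norm_mul]
    gcongr
    exacts [norm_one_le_simError φ ξ _, norm_two_le_simError φ ξ _]
  have h0 := hz n le_rfl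
  have h1 := hz (n + 1) (by omega)
  have h2 := hz (n + 2) (by omega)
  have hd := hdet n
  generalize x n = p, x (n + 1) = q, x (n + 2) = r at *
  refine ⟨(mul_eq_zero.1 ?_).resolve_left hd, (mul_eq_zero.1 ?_).resolve_left hd,
    (mul_eq_zero.1 ?_).resolve_left hd⟩ <;> unfold tripleDet
  · linear_combination (q 1 * r 2 - q 2 * r 1) * h0 - (p 1 * r 2 - p 2 * r 1) * h1 +
      (p 1 * q 2 - p 2 * q 1) * h2
  · linear_combination (q 2 * r 0 - q 0 * r 2) * h0 - (p 2 * r 0 - p 0 * r 2) * h1 +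
      (p 2 * q 0 - p 0 * q 2) * h2
  · linear_combination (q 0 * r 1 - q 1 * r 0) * h0 - (p 0 * r 1 - p 1 * r 0) * h1 +
      (p 0 * q 1 - p 1 * q 0) * h2

variable {a b : A}

theorem exists_norm_fibEnd_le (φ : A →+* F) (a b : A) :
    ∃ M : ℝ, 0 < M ∧ ∀ n i j, ‖φ (fibEnd a b n i j)‖ ≤ M := by
  refine ⟨1 + ∑ i, ∑ j, (‖φ (fibEnd a b 0 i j)‖ + ‖φ (fibEnd a b 1 i j)‖), by positivity, ?_⟩
  have key : ∀ (i j : Fin 2), ‖φ (fibEnd a b 0 i j)‖ + ‖φ (fibEnd a b 1 i j)‖ ≤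
      1 + ∑ i, ∑ j, (‖φ (fibEnd a b 0 i j)‖ + ‖φ (fibEnd a b 1 i j)‖) := by
    intro i j
    have h1 := Finset.single_le_sum
      (f := fun j => ‖φ (fibEnd a b 0 i j)‖ + ‖φ (fibEnd a b 1 i j)‖)
      (fun _ _ => by positivity) (Finset.mem_univ j)
    have h2 := Finset.single_le_sum
      (f := fun i => ∑ j, (‖φ (fibEnd a b 0 i j)‖ + ‖φ (fibEnd a b 1 i j)‖))
      (fun _ _ => by positivity) (Finset.mem_univ i)
    exact (h1.trans h2).trans (by linarith)
  intro n i j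
  induction n using Nat.twoStepInduction with
  | zero => linarith [key i j, norm_nonneg (φ (fibEnd a b 1 i j))]
  | one => linarith [key i j, norm_nonneg (φ (fibEnd a b 0 i j))]
  | more n ih _ => exact ih

/-- The denominator of the convergent given by the finite word `fibWord a b n`. -/
def fibDen (a b : A) (n : ℕ) : A := cfDen (fibLetter a b) (fibWord a b n).length

theorem length_fibWord_eq {α : Type*} (a b : α) (n : ℕ) : ∃ k, (fibWord a b n).length = k + 1 :=
  ⟨(fibWord a b n).length - 1, by have := lt_length_fibWord a b n; omega⟩

theorem fibDen_add_two (a b : A) {n k l : ℕ} (hk : (fibWord a b (n + 1)).length = k + 1)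
    (hl : (fibWord a b n).length = l + 1) :
    fibDen a b (n + 2) = fibDen a b (n + 1) * fibDen a b n +
      cfDen (fibLetter a b) k * cfNum (fibLetter a b) (l + 1) := by
  obtain ⟨m, hm⟩ := length_fibWord_eq a b (n + 2)
  have h := prod_fibWord_eq a b hm
  rw [fibWord, List.map_append, List.prod_append, prod_fibWord_eq a b hk,
    prod_fibWord_eq a b hl] at h
  have := congrFun (congrFun h 0) 0
  simp [Matrix.mul_apply, Fin.sum_univ_two] at this
  rw [fibDen, fibDen, fibDen, hm, hk, hl, ← this]

theorem four_le_norm_fibLetter (ha : 4 ≤ ‖φ a‖) (hb : 4 ≤ ‖φ b‖) (n : ℕ) :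
    4 ≤ ‖(φ ∘ fibLetter a b) n‖ := by
  rcases fibLetter_eq_or a b n with h | h <;> rwa [Function.comp, h]

/-- In `fibDen_add_two` the correction term is at most a third of the main product: dropping one
letter divides the denominator by at least `3`, and numerators do not exceed denominators. -/
theorem fibDen_ratio [CompleteSpace F] (ha : 4 ≤ ‖φ a‖) (hb : 4 ≤ ‖φ b‖) (n : ℕ) :
    ‖φ (fibDen a b (n + 2))‖ ≤ 2 * (‖φ (fibDen a b (n + 1))‖ * ‖φ (fibDen a b n)‖) ∧
    ‖φ (fibDen a b (n + 1))‖ * ‖φ (fibDen a b n)‖ ≤ 2 * ‖φ (fibDen a b (n + 2))‖ := by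
  obtain ⟨k, hk⟩ := length_fibWord_eq a b (n + 1)
  obtain ⟨l, hl⟩ := length_fibWord_eq a b n
  have hu := four_le_norm_fibLetter ha hb
  have h1 := (cfDen_growth hu k).2
  have h2 := norm_cfNum_le hu (l + 1)
  have h3 := norm_nonneg (cfNum (φ ∘ fibLetter a b) (l + 1))
  have h4 := norm_nonneg (cfDen (φ ∘ fibLetter a b) k)
  simp only [← map_cfDen, ← map_cfNum] at h1 h2 h3 h4
  rw [← hk] at h1
  rw [← hl] at h2
  rw [fibDen_add_two a b hk hl, map_add, map_mul, map_mul, ← hl]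
  rw [← hl] at h3
  change 3 * _ ≤ ‖φ (fibDen a b (n + 1))‖ at h1
  change _ ≤ ‖φ (fibDen a b n)‖ at h2
  have h5 : ‖φ (cfDen (fibLetter a b) k) * φ (cfNum (fibLetter a b) (fibWord a b n).length)‖ ≤
      1 / 3 * (‖φ (fibDen a b (n + 1))‖ * ‖φ (fibDen a b n)‖) := by
    rw [norm_mul, ← mul_assoc]
    gcongr
    linarith
  have h6 := norm_add_le (φ (fibDen a b (n + 1)) * φ (fibDen a b n))
    (φ (cfDen (fibLetter a b) k) * φ (cfNum (fibLetter a b) (fibWord a b n).length))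
  have h7 := norm_sub_le_norm_add (φ (fibDen a b (n + 1)) * φ (fibDen a b n))
    (φ (cfDen (fibLetter a b) k) * φ (cfNum (fibLetter a b) (fibWord a b n).length))
  rw [norm_mul] at h6 h7
  have h8 : 0 ≤ ‖φ (fibDen a b (n + 1))‖ * ‖φ (fibDen a b n)‖ := by positivity
  constructor <;> linarith

theorem pow_le_norm_fibDen (ha : 4 ≤ ‖φ a‖) (hb : 4 ≤ ‖φ b‖) (n : ℕ) :
    3 ^ n ≤ ‖φ (fibDen a b n)‖ := by
  have h := pow_mul_le_norm_cfDen (four_le_norm_fibLetter ha hb) 0 (fibWord a b n).length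
  rw [zero_add, cfDen, norm_one, mul_one,
    ← map_cfDen] at h
  exact (pow_le_pow_right₀ (by norm_num) (lt_length_fibWord a b n).le).trans h

/-- By `fibSym_eq_mul_adjugate`, the entries of `fibSym` are combinations of two consecutive
convergents with bounded coefficients. Symmetry provides two expressions for the off-diagonal entry:
one pairs with the entry `0 0`, the other with the entry `1 1`, so both ratios approximate `ξ`. -/
theorem fibPoint_bounds (ha : 4 ≤ ‖φ a‖) (hb : 4 ≤ ‖φ b‖)
    (hξ : Tendsto (fun n => cfNum (φ ∘ fibLetter a b) n / cfDen (φ ∘ fibLetter a b) n) atTop (𝓝 ξ))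
    {M : ℝ} (hM : ∀ n i j, ‖φ (fibEnd a b n i j)‖ ≤ M) (n : ℕ) :
    ‖φ (fibPoint a b n 0)‖ ≤ 2 * M * ‖φ (fibDen a b n)‖ ∧
    simError φ ξ (fibPoint a b n) ≤ 4 * M * (1 + ‖ξ‖) / ‖φ (fibDen a b n)‖ := by
  obtain ⟨k, hk⟩ := length_fibWord_eq a b n
  have hS := fibSym_eq_mul_adjugate a b n
  rw [prod_fibWord_eq a b hk, Matrix.adjugate_fin_two] at hS
  have hsymm := fibSym_one_zero a b n
  have hu := four_le_norm_fibLetter ha hb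
  have hM' := hM n
  obtain ⟨e00, he00⟩ : ∃ e, e = fibEnd a b n 0 0 := ⟨_, rfl⟩
  obtain ⟨e01, he01⟩ : ∃ e, e = fibEnd a b n 0 1 := ⟨_, rfl⟩
  obtain ⟨e10, he10⟩ : ∃ e, e = fibEnd a b n 1 0 := ⟨_, rfl⟩
  obtain ⟨e11, he11⟩ : ∃ e, e = fibEnd a b n 1 1 := ⟨_, rfl⟩
  have m00 : ‖φ e00‖ ≤ M := he00 ▸ hM' 0 0
  have m01 : ‖φ e01‖ ≤ M := he01 ▸ hM' 0 1
  have m10 : ‖φ e10‖ ≤ M := he10 ▸ hM' 1 0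
  have m11 : ‖φ e11‖ ≤ M := he11 ▸ hM' 1 1
  rw [← he00, ← he01, ← he10, ← he11] at hS
  have hM0 : 0 ≤ M := (norm_nonneg _).trans m00
  have g0 := (cfDen_growth hu k)
  have g1 := (cfDen_growth hu (k + 1))
  have a0 := norm_cfDen_mul_sub_le hu hξ k
  have a1 := norm_cfDen_mul_sub_le hu hξ (k + 1)
  simp only [← map_cfDen, ← map_cfNum] at g0 g1 a0 a1
  rw [fibDen, hk]
  generalize cfDen (fibLetter a b) k = q, cfDen (fibLetter a b) (k + 1) = q',
    cfDen (fibLetter a b) (k + 1 + 1) = q'', cfNum (fibLetter a b) k = p,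
    cfNum (fibLetter a b) (k + 1) = p' at *
  have s00 : fibSym a b n 0 0 = q' * e11 - q * e10 := by
    rw [hS]; simp [Matrix.mul_apply, Fin.sum_univ_two, sub_eq_add_neg]
  have s01 : fibSym a b n 0 1 = q * e00 - q' * e01 := by
    rw [hS]; simp [Matrix.mul_apply, Fin.sum_univ_two]; ring
  have s10 : fibSym a b n 0 1 = p' * e11 - p * e10 := by
    rw [← hsymm, hS]; simp [Matrix.mul_apply, Fin.sum_univ_two, sub_eq_add_neg]
  have s11 : fibSym a b n 1 1 = p * e00 - p' * e01 := by
    rw [hS]; simp [Matrix.mul_apply, Fin.sum_univ_two]; ring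
  have hq' : 0 < ‖φ q'‖ := by linarith
  have a1' : ‖φ q' * ξ - φ p'‖ ≤ 2 / ‖φ q'‖ := a1.trans (by gcongr; linarith)
  have lin : ∀ s t : A, ‖φ s‖ ≤ M → ‖φ t‖ ≤ M →
      ‖φ s * (φ q' * ξ - φ p') - φ t * (φ q * ξ - φ p)‖ ≤ 4 * M / ‖φ q'‖ := by
    intro s t hs ht
    refine (norm_sub_le _ _).trans ?_
    rw [norm_mul, norm_mul]
    calc _ ≤ M * (2 / ‖φ q'‖) + M * (2 / ‖φ q'‖) := by gcongr
      _ = _ := by ring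
  have d1 : ‖φ (fibSym a b n 0 0) * ξ - φ (fibSym a b n 0 1)‖ ≤ 4 * M / ‖φ q'‖ := by
    refine (congrArg _ ?_).trans_le (lin e11 e10 m11 m10)
    rw [s00, s10]; simp only [map_sub, map_mul]; ring
  have d2 : ‖φ (fibSym a b n 0 1) * ξ - φ (fibSym a b n 1 1)‖ ≤ 4 * M / ‖φ q'‖ := by
    rw [norm_sub_rev]
    refine (congrArg _ ?_).trans_le (lin e01 e00 m01 m00)
    rw [s01, s11]; simp only [map_sub, map_mul]; ring
  refine ⟨?_, max_le ?_ ?_⟩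
  · change ‖φ (fibSym a b n 0 0)‖ ≤ _
    rw [s00, map_sub, map_mul, map_mul]
    refine (norm_sub_le _ _).trans ?_
    rw [norm_mul, norm_mul]
    have : ‖φ q‖ ≤ ‖φ q'‖ := by linarith
    calc _ ≤ ‖φ q'‖ * M + ‖φ q'‖ * M := by gcongr
      _ = _ := by ring
  · change ‖φ (fibSym a b n 0 0) * ξ - φ (fibSym a b n 0 1)‖ ≤ _
    exact d1.trans (div_le_div_of_nonneg_right
      (le_mul_of_one_le_right (by positivity) (by linarith [norm_nonneg ξ])) hq'.le)
  · change ‖φ (fibSym a b n 0 0) * ξ ^ 2 - φ (fibSym a b n 1 1)‖ ≤ _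
    -- Approximating `ξ` by two successive ratios gives the approximation of `ξ²`.
    have e : φ (fibSym a b n 0 0) * ξ ^ 2 - φ (fibSym a b n 1 1) =
        ξ * (φ (fibSym a b n 0 0) * ξ - φ (fibSym a b n 0 1)) +
        (φ (fibSym a b n 0 1) * ξ - φ (fibSym a b n 1 1)) := by ring
    rw [e]
    refine (norm_add_le _ _).trans ?_
    rw [norm_mul]
    calc _ ≤ ‖ξ‖ * (4 * M / ‖φ q'‖) + 4 * M / ‖φ q'‖ := by gcongr
      _ = _ := by ring

theorem uniformly_approximable_fib [IsDomain A] [CompleteSpace F]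
    (hφ : ∀ a, a ≠ 0 → 1 ≤ ‖φ a‖) (hab : a ≠ b)
    (ha : 4 ≤ ‖φ a‖) (hb : 4 ≤ ‖φ b‖) :
    ∃ ξ, Tendsto (fun n => (fibContFract (φ a) (φ b)).convs n) atTop (𝓝 ξ) ∧
      (∀ a b c : A, φ a + φ b * ξ + φ c * ξ ^ 2 = 0 → a = 0 ∧ b = 0 ∧ c = 0) ∧
      ∃ c : ℝ, 0 < c ∧ ∃ X₀ : ℝ, ∀ X : ℝ, X₀ ≤ X → ∃ x : Fin 3 → A, x ≠ 0 ∧ ‖φ (x 0)‖ ≤ X ∧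
        simError φ ξ x ≤ c * X ^ (-1 / Real.goldenRatio) := by
  obtain ⟨ξ, hξ⟩ := exists_limit_convergents (four_le_norm_fibLetter ha hb)
  obtain ⟨M, hM0, hM⟩ := exists_norm_fibEnd_le φ a b
  have hbd := fibPoint_bounds ha hb hξ hM
  have hQ := pow_le_norm_fibDen ha hb
  have hQlim : Tendsto (fun n => ‖φ (fibDen a b n)‖) atTop atTop :=
    tendsto_atTop_mono hQ (tendsto_pow_atTop_atTop_of_one_lt (by norm_num))
  have hQ1 : ∀ n, 1 ≤ ‖φ (fibDen a b n)‖ := fun n => (one_le_pow₀ (by norm_num)).trans (hQ n)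
  refine ⟨ξ, ?_, ?_, ?_⟩
  · have e : φ ∘ fibLetter a b = fibLetter (φ a) (φ b) := funext fun n => map_fibLetter φ a b n
    simpa only [fibContFract_convs, e] using hξ
  · refine linear_relation_trivial_of_seq hφ ?_ (tripleDet_fibPoint_ne_zero hab)
    exact squeeze_zero (fun n => simError_nonneg _ _ _) (fun n => (hbd n).2)
      (hQlim.const_div_atTop _)
  · obtain ⟨C, hC0, hC⟩ := exists_rpow_inv_goldenRatio_le hQ1
      (fun n => (fibDen_ratio ha hb n).1) (fun n => (fibDen_ratio ha hb n).2)
    obtain ⟨c, hc, X₀, h⟩ := exists_uniform_of_seq (f := fun x : Fin 3 → A => ‖φ (x 0)‖)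
      (g := simError φ ξ) (fun n => one_pos.trans_le (hQ1 n)) hQlim hC0
      (by positivity : 0 < 2 * M) (by positivity : 0 < 4 * M * (1 + ‖ξ‖)) hC
      (fun n => (hbd n).1) (fun n => (hbd n).2)
    refine ⟨c, hc, X₀, fun X hX => ?_⟩
    obtain ⟨n, hn⟩ := h X hX
    exact ⟨_, fibPoint_ne_zero hab n, hn⟩

end UpperBound

/-! ### Transfer to the completion of the fraction field. -/

section Completion

variable {A K : Type*} [CommRing A] [Field K] [Algebra A K] (v : AbsoluteValue K ℝ)

theorem norm_algebraMap_completion (x : K) : ‖algebraMap K v.Completion x‖ = v x := by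
  exact UniformSpace.Completion.norm_coe (WithAbs.toAbs v x)

theorem norm_toCompletion (a : A) : ‖toCompletion A v a‖ = v (algebraMap A K a) :=
  norm_algebraMap_completion v _

theorem isSolution_iff (ξ : v.Completion) (c X : ℝ) (x : Fin 3 → A) :
    IsSolution v ξ c X x ↔ x ≠ 0 ∧ ‖toCompletion A v (x 0)‖ ≤ X ∧
      simError (toCompletion A v) ξ x ≤ c * X ^ (-1 / Real.goldenRatio) := by
  rw [norm_toCompletion]
  rfl

theorem linearIndependent_completion_iff [IsDomain A] [IsFractionRing A K] (ξ : v.Completion) :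
    LinearIndependent K ![1, ξ, ξ ^ 2] ↔ ∀ a b c : A, toCompletion A v a + toCompletion A v b * ξ +
      toCompletion A v c * ξ ^ 2 = 0 → a = 0 ∧ b = 0 ∧ c = 0 := by
  have inj := IsFractionRing.injective A K
  rw [Fintype.linearIndependent_iff]
  simp only [Fin.sum_univ_three, Algebra.smul_def, Matrix.cons_val_zero, Matrix.cons_val_one,
    Matrix.cons_val, mul_one]
  constructor
  · intro h a b c habc
    have h' := h ![algebraMap A K a, algebraMap A K b, algebraMap A K c] habc
    refine ⟨?_, ?_, ?_⟩ <;> rw [← map_eq_zero_iff _ inj]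
    exacts [h' 0, h' 1, h' 2]
  · intro h g hg
    obtain ⟨d, hd⟩ := IsLocalization.exist_integer_multiples_of_finite (nonZeroDivisors A) g
    choose n hn using hd
    simp only [Algebra.smul_def] at hn
    have hd0 : algebraMap A K d ≠ 0 :=
      (map_ne_zero_iff _ inj).2 (nonZeroDivisors.coe_ne_zero d)
    obtain ⟨h0, h1, h2⟩ := h (n 0) (n 1) (n 2) (by
      simp only [toCompletion, RingHom.comp_apply, hn, map_mul]
      linear_combination algebraMap K v.Completion (algebraMap A K d) * hg)
    have hn0 : ∀ i, n i = 0 := fun i => by fin_cases i <;> assumption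
    intro i
    have := hn i
    rw [hn0 i, map_zero] at this
    exact (mul_eq_zero.1 this.symm).resolve_left hd0

/-- A fraction of absolute value above `1` has a numerator `p` with `|p| > 1`, because its
denominator has absolute value at least `1`. Two successive high powers of `p` serve as letters. The
bound `4` rather than `2` gives room for the crude growth estimates. -/
theorem exists_four_le [IsDomain A] [IsFractionRing A K] (hv : v.IsNontrivial)
    (hA : ∀ a : A, a ≠ 0 → 1 ≤ v (algebraMap A K a)) :
    ∃ a b : A, a ≠ b ∧ 4 ≤ v (algebraMap A K a) ∧ 4 ≤ v (algebraMap A K b) := by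
  obtain ⟨x, hx⟩ := hv.exists_abv_gt_one
  obtain ⟨p, q, hq, rfl⟩ := IsFractionRing.div_surjective (A := A) x
  have hq1 := hA q (nonZeroDivisors.ne_zero hq)
  rw [map_div₀, one_lt_div (by linarith)] at hx
  have hp : 1 < v (algebraMap A K p) := hq1.trans_lt hx
  obtain ⟨n, hn⟩ := pow_unbounded_of_one_lt 4 hp
  have hlt : v (algebraMap A K p) ^ n < v (algebraMap A K p) ^ (n + 1) :=
    pow_lt_pow_right₀ hp n.lt_succ_self
  refine ⟨p ^ n, p ^ (n + 1), fun h => ?_, ?_, ?_⟩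
  · have := congrArg (fun a => v (algebraMap A K a)) h
    simp only [map_pow] at this
    exact hlt.ne this
  · rw [map_pow, map_pow]; exact hn.le
  · rw [map_pow, map_pow]; exact (hn.trans hlt).le

end Completion

theorem mainTheorem1 {A K : Type*} [CommRing A] [IsDomain A] [Field K] [Algebra A K]
    [IsFractionRing A K] (v : AbsoluteValue K ℝ) (hv : v.IsNontrivial)
    (hA : ∀ a : A, a ≠ 0 → 1 ≤ v (algebraMap A K a)) :
    (UniqueFactorizationMonoid A →
      ∀ ξ : v.Completion, LinearIndependent K ![1, ξ, ξ ^ 2] →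
        ∃ c₁ : ℝ, 0 < c₁ ∧ ∀ B : ℝ, ∃ X : ℝ, B ≤ X ∧
          ¬ ∃ x : Fin 3 → A, IsSolution v ξ c₁ X x) ∧
    (∃ ξ : v.Completion,
      (∃ a b : A, a ≠ b ∧ 2 < v (algebraMap A K a) ∧ 2 < v (algebraMap A K b) ∧
        Tendsto (fun n : ℕ => (fibContFract (toCompletion A v a) (toCompletion A v b)).convs n)
          atTop (𝓝 ξ)) ∧
      LinearIndependent K ![1, ξ, ξ ^ 2] ∧
      ∃ c₂ : ℝ, 0 < c₂ ∧ ∃ X₀ : ℝ, ∀ X : ℝ, X₀ ≤ X →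
        ∃ x : Fin 3 → A, IsSolution v ξ c₂ X x) := by
  have hφ : ∀ a : A, a ≠ 0 → 1 ≤ ‖toCompletion A v a‖ := fun a ha =>
    (hA a ha).trans_eq (norm_toCompletion v a).symm
  simp only [isSolution_iff, linearIndependent_completion_iff (A := A)]
  refine ⟨fun _ ξ hξ => not_uniformly_approximable hφ hξ, ?_⟩
  obtain ⟨a, b, hab, ha, hb⟩ := exists_four_le v hv hA
  obtain ⟨ξ, hlim, hind, hsol⟩ := uniformly_approximable_fib hφ hab
    (ha.trans_eq (norm_toCompletion v a).symm) (hb.trans_eq (norm_toCompletion v b).symm)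
  exact ⟨ξ, ⟨a, b, hab, by linarith, by linarith, hlim⟩, hind, hsol⟩
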